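/- Let $K$ be an infinite field. A (non-associative) $K$-algebra is a $K$-vector space with a bilinear multiplication, not assumed associative or unital; morphisms are the product-preserving linear maps. A variety of $K$-algebras is a class of $K$-algebras defined by a set of identities $p=0$, with $p$ a non-associative polynomial over $K$, regarded as a full subcategory of the category of $K$-algebras; a subvariety of $\mathcal V$ is a variety contained in $\mathcal V$. A variety of alternating $K$-algebras is one in which $xx=0$ is a law, and $\mathsf{Lie}_K$ is the variety defined by $xx=0$ together with the Jacobi identity $x(yz)+z(xy)+y(zx)=0$. For an object $B$ of a category $\mathcal C$, $\mathsf{Pt}_B(\mathcal C)$ denotes the category of split epimorphisms $X\to B$ with a chosen section, with morphisms the morphisms over $B$ that preserve the sections. A category $\mathcal C$ is locally algebraically cartesian closed (LACC) if it has finite limits and, for every morphism $a\colon A\to B$ in $\mathcal C$, the pullback functor $a^*\colon\mathsf{Pt}_B(\mathcal C)\to\mathsf{Pt}_A(\mathcal C)$ has a right adjoint. 1. If $\mathcal V$ is an LACC variety of alternating $K$-algebras, then $\mathcal V$ is a subvariety of $\mathsf{Lie}_K$. 2. $\mathsf{Lie}_K$ is itself LACC, and hence is the largest LACC variety of alternating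 $K$-algebras. 3. For every variety $\mathcal V$ of alternating $K$-algebras, the following are equivalent: (i) $\mathcal V$ is a subvariety of some LACC variety of alternating $K$-algebras; (ii) the Jacobi identity is a law in $\mathcal V$. -/

import Mathlib

open CategoryTheory CategoryTheory.Limits

universe u v w

/-! ### Points over an object, change of base, local algebraic cartesian closedness -/

/-- A point over `B`: a split epimorphism `π : X ⟶ B` together with a chosen section `σ`. -/
structure PointOver {C : Type w} [Category.{v} C] (B : C) where
  /-- The total object. -/
  X : C
  /-- The split epimorphism. -/
  π : X ⟶ B
  /-- The chosen section. -/
  σ : B ⟶ X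
  section_comp : σ ≫ π = 𝟙 B

namespace PointOver

/-- Morphisms of points over `B`: morphisms of the total objects compatible with the split
epimorphisms and with the sections. -/
@[ext]
structure Hom {C : Type w} [Category.{v} C] {B : C} (P Q : PointOver B) where
  /-- The morphism between the total objects. -/
  f : P.X ⟶ Q.X
  comp_π : f ≫ Q.π = P.π
  σ_comp : P.σ ≫ f = Q.σ

/-- The category `Pt_B(C)` of points over `B`. -/
instance {C : Type w} [Category.{v} C] (B : C) : Category (PointOver B) where
  Hom P Q := Hom P Q
  id P := ⟨𝟙 P.X, Category.id_comp _, Category.comp_id _⟩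
  comp g h := ⟨g.f ≫ h.f, by rw [Category.assoc, h.comp_π, g.comp_π],
    by rw [← Category.assoc, g.σ_comp, h.σ_comp]⟩
  id_comp g := Hom.ext (Category.id_comp g.f)
  comp_id g := Hom.ext (Category.comp_id g.f)
  assoc g h k := Hom.ext (Category.assoc g.f h.f k.f)

@[simp] lemma id_f {C : Type w} [Category.{v} C] {B : C} (P : PointOver B) :
    Hom.f (𝟙 P) = 𝟙 P.X := rfl

@[simp] lemma comp_f {C : Type w} [Category.{v} C] {B : C} {P Q R : PointOver B}
    (g : P ⟶ Q) (h : Q ⟶ R) : Hom.f (g ≫ h) = Hom.f g ≫ Hom.f h := rfl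

@[ext] lemma hom_ext {C : Type w} [Category.{v} C] {B : C} {P Q : PointOver B}
    {g h : P ⟶ Q} (e : Hom.f g = Hom.f h) : g = h := Hom.ext e

/-- The change-of-base functor `a^* : Pt_B(C) ⥤ Pt_A(C)` along `a : A ⟶ B`: it sends `(π, σ)` to
the projection `A ×_B X ⟶ A` with the section induced by `𝟙 A` and `a ≫ σ`. -/
noncomputable def changeOfBase {C : Type w} [Category.{v} C] [HasPullbacks C] {A B : C}
    (a : A ⟶ B) : PointOver B ⥤ PointOver A where
  obj P :=
    { X := pullback a P.π
      π := pullback.fst a P.π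
      σ := pullback.lift (𝟙 A) (a ≫ P.σ) (by simp [P.section_comp])
      section_comp := pullback.lift_fst _ _ _ }
  map {P Q} g :=
    { f := pullback.lift (pullback.fst a P.π) (pullback.snd a P.π ≫ g.f)
        (pullback.condition.trans
          ((congrArg (pullback.snd a P.π ≫ ·) g.comp_π.symm).trans (Category.assoc _ _ _).symm))
      comp_π := pullback.lift_fst _ _ _
      σ_comp := by
        apply pullback.hom_ext
        · simp only [Category.assoc, pullback.lift_fst]
        · simp only [Category.assoc, pullback.lift_snd, pullback.lift_snd_assoc, g.σ_comp] }
  map_id P := by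
    apply hom_ext
    apply pullback.hom_ext <;> simp
  map_comp g h := by
    apply hom_ext
    apply pullback.hom_ext
    · simp only [comp_f, Category.assoc, pullback.lift_fst]
    · simp only [comp_f, Category.assoc, pullback.lift_snd, pullback.lift_snd_assoc]

end PointOver

/-- A category is locally algebraically cartesian closed when it has finite limits and every
change-of-base functor between its categories of points has a right adjoint. -/
def IsLACC (C : Type w) [Category.{v} C] : Prop :=
  ∃ _ : HasFiniteLimits C, ∀ (A B : C) (a : A ⟶ B), (PointOver.changeOfBase a).IsLeftAdjoint

/-! ### The category of non-associative algebras -/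

/-- A (not necessarily associative or unital) algebra over `K`: a `K`-vector space with a
bilinear multiplication. -/
structure NonAssocAlgCat (K : Type u) [Field K] where
  /-- The underlying type. -/
  carrier : Type u
  [ring : NonUnitalNonAssocRing carrier]
  [module : Module K carrier]
  [isScalarTower : IsScalarTower K carrier carrier]
  [smulCommClass : SMulCommClass K carrier carrier]

namespace NonAssocAlgCat

attribute [instance] ring module isScalarTower smulCommClass

instance (K : Type u) [Field K] : CoeSort (NonAssocAlgCat K) (Type u) := ⟨carrier⟩

/-- Morphisms of algebras: product-preserving linear maps. -/
@[ext]
structure Hom {K : Type u} [Field K] (A B : NonAssocAlgCat K) where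
  /-- The underlying product-preserving linear map. -/
  hom' : A →ₙₐ[K] B

instance (K : Type u) [Field K] : Category (NonAssocAlgCat K) where
  Hom A B := Hom A B
  id A := ⟨NonUnitalAlgHom.id K A⟩
  comp f g := ⟨g.hom'.comp f.hom'⟩

instance (K : Type u) [Field K] :
    ConcreteCategory (NonAssocAlgCat K) (fun A B => A →ₙₐ[K] B) where
  hom := Hom.hom'
  ofHom := Hom.mk

end NonAssocAlgCat

/-! ### Laws and varieties -/

/-- Non-associative polynomials over `K` in the variables `x₀, x₁, x₂, …`. -/
abbrev NAPoly (K : Type u) [Field K] : Type u := FreeNonUnitalNonAssocAlgebra K ℕ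

namespace NAPoly

/-- The variable `xᵢ`. -/
noncomputable def x (K : Type u) [Field K] (i : ℕ) : NAPoly K := FreeNonUnitalNonAssocAlgebra.of K i

/-- The polynomial `x₀x₀`. -/
noncomputable def square (K : Type u) [Field K] : NAPoly K := x K 0 * x K 0

/-- The polynomial `x(yz) + z(xy) + y(zx)`. -/
noncomputable def jacobi (K : Type u) [Field K] : NAPoly K :=
  x K 0 * (x K 1 * x K 2) + x K 2 * (x K 0 * x K 1) + x K 1 * (x K 2 * x K 0)

end NAPoly

namespace NonAssocAlgCat

/-- The identity `p = 0` holds in `A`: every evaluation of `p` in `A` vanishes. -/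
def Satisfies {K : Type u} [Field K] (A : NonAssocAlgCat K) (p : NAPoly K) : Prop :=
  ∀ e : ℕ → A, FreeNonUnitalNonAssocAlgebra.lift K e p = 0

/-- The class of all algebras satisfying `p = 0` for every `p ∈ E`. -/
def models {K : Type u} [Field K] (E : Set (NAPoly K)) : ObjectProperty (NonAssocAlgCat K) :=
  fun A => ∀ p ∈ E, A.Satisfies p

/-- A variety of algebras is an equationally defined class of algebras. It is regarded as a
category through `ObjectProperty.FullSubcategory`. -/
def IsVariety {K : Type u} [Field K] (V : ObjectProperty (NonAssocAlgCat K)) : Prop :=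
  ∃ E : Set (NAPoly K), V = models E

/-- `p = 0` is a law in the class `V`. -/
def IsLaw {K : Type u} [Field K] (V : ObjectProperty (NonAssocAlgCat K)) (p : NAPoly K) : Prop :=
  ∀ A : NonAssocAlgCat K, V A → A.Satisfies p

/-- The variety of alternating algebras, defined by `xx = 0`. -/
def alternating (K : Type u) [Field K] : ObjectProperty (NonAssocAlgCat K) :=
  models {NAPoly.square K}

/-- The variety of Lie algebras, defined by `xx = 0` and the Jacobi identity. -/
def lie (K : Type u) [Field K] : ObjectProperty (NonAssocAlgCat K) :=
  models {NAPoly.square K, NAPoly.jacobi K}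

/-- `V` is a variety of alternating algebras. -/
def IsAlternatingVariety {K : Type u} [Field K] (V : ObjectProperty (NonAssocAlgCat K)) : Prop :=
  IsVariety V ∧ V ≤ alternating K

end NonAssocAlgCat

/-! For Lie algebras, a point over `B` is a semidirect sum of `B` with its kernel, on which `B` acts
by derivations, and change of base along `a : A ⟶ B` restricts the action to `A`. The right adjoint
is coinduction. For a kernel `L` with an action of `A`, the coinduced object is a concrete form of
Hom over U(A) from U(B) to `L`. Its elements are functions of words in `B` that are linear in each
letter, respect the bracket of `B`, and are equivariant for `A`. The bracket is convolution along
the unshuffle coproduct, for which each `b` acts by a derivation. An equivariant map `θ` on a kernel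
corresponds to `k ↦ (l ↦ θ(l · k))`; see `conv_mem`, `SemidirectSum.isLieMul`, `eq_toSemidirectSum`
and `isLACC_lie`.

For the converse, one change of base is enough: the kernel functor along the map from the trivial
algebra to the free algebra F(b). Being a left adjoint, it preserves coproducts. The free point
F(b,x,y) over F(b) is the coproduct of F(b,x) and F(b,y), so the kernel of F(b,x,y) is the coproduct
of the two smaller kernels. That the smaller kernels generate it, together with multihomogeneity
over an infinite field, gives a law b(xy) = c (bx)y + d x(by) (`exists_mul_mul_eq`). That maps out
of the smaller kernels can be prescribed independently shows that (bx)y and x(by) satisfy no linear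
relation unless all products vanish (`eq_zero_of_law`). Exchanging x and y then gives c = d, and
applying the law to x(by) gives c = 1, which is the Jacobi identity (`models_le_lie`). If all
products vanish, Jacobi is trivial. -/

namespace NonAssocAlgCat

variable {K : Type u} [Field K]

/-! ### Closure properties of equational classes -/

lemma map_lift {σ : Type*} {A B : Type*} [NonUnitalNonAssocRing A] [Module K A]
    [IsScalarTower K A A] [SMulCommClass K A A] [NonUnitalNonAssocRing B] [Module K B]
    [IsScalarTower K B B] [SMulCommClass K B B] (f : A →ₙₐ[K] B) (e : σ → A)
    (p : FreeNonUnitalNonAssocAlgebra K σ) :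
    f (FreeNonUnitalNonAssocAlgebra.lift K e p) =
      FreeNonUnitalNonAssocAlgebra.lift K (fun i => f (e i)) p := by
  have h : f.comp (FreeNonUnitalNonAssocAlgebra.lift K e) =
      FreeNonUnitalNonAssocAlgebra.lift K (fun i => f (e i)) := by
    refine FreeNonUnitalNonAssocAlgebra.hom_ext _ fun i => ?_
    simp only [NonUnitalAlgHom.comp_apply, FreeNonUnitalNonAssocAlgebra.lift_of_apply]
  exact DFunLike.congr_fun h p

/-- An equational class contains every algebra with a jointly injective family of
morphisms to algebras in the class. -/
lemma models_of_jointly_injective {E : Set (NAPoly K)} {A : NonAssocAlgCat K} {ι : Type*}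
    (B : ι → NonAssocAlgCat K) (hB : ∀ i, models E (B i)) (f : ∀ i, A →ₙₐ[K] B i)
    (hf : ∀ x : A, (∀ i, f i x = 0) → x = 0) : models E A := by
  intro p hp e
  refine hf _ fun i => ?_
  rw [map_lift]
  exact hB i p hp _

lemma models_of_injective {E : Set (NAPoly K)} {A B : NonAssocAlgCat K} (hB : models E B)
    (f : A →ₙₐ[K] B) (hf : Function.Injective f) : models E A :=
  models_of_jointly_injective (fun _ : Unit => B) (fun _ => hB) (fun _ => f)
    fun _ h => hf ((h ()).trans (map_zero f).symm)

lemma models_subalgebra {E : Set (NAPoly K)} {A : NonAssocAlgCat K} (hA : models E A)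
    (S : NonUnitalSubalgebra K A) : models E (⟨S⟩ : NonAssocAlgCat K) :=
  models_of_injective hA (NonUnitalSubalgebraClass.subtype S) Subtype.coe_injective

lemma models_prod {E : Set (NAPoly K)} {A B : NonAssocAlgCat K} (hA : models E A)
    (hB : models E B) : models E (⟨A × B⟩ : NonAssocAlgCat K) :=
  models_of_jointly_injective (fun b : Bool => if b then A else B)
    (by rintro (_ | _) <;> assumption)
    (fun b => match b with
      | true => NonUnitalAlgHom.fst K A B
      | false => NonUnitalAlgHom.snd K A B)
    fun _ h => Prod.ext (h true) (h false)

lemma models_punit (E : Set (NAPoly K)) : models E (⟨PUnit⟩ : NonAssocAlgCat K) :=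
  fun _ _ _ => rfl

/-! ### Morphisms and limits in an equational class -/

section Category

variable {E : Set (NAPoly K)}

/-- The product-preserving linear map underlying a morphism of a full subcategory. -/
abbrev asHom {V : ObjectProperty (NonAssocAlgCat K)} {X Y : V.FullSubcategory} (f : X ⟶ Y) :
    X.obj →ₙₐ[K] Y.obj := f.hom.hom'

/-- A product-preserving linear map, as a morphism of a full subcategory. -/
abbrev ofHom {V : ObjectProperty (NonAssocAlgCat K)} {X Y : V.FullSubcategory}
    (f : X.obj →ₙₐ[K] Y.obj) : X ⟶ Y := ObjectProperty.homMk ⟨f⟩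

lemma hom_ext_apply {V : ObjectProperty (NonAssocAlgCat K)} {X Y : V.FullSubcategory}
    {f g : X ⟶ Y} (h : ∀ x, asHom f x = asHom g x) : f = g :=
  ObjectProperty.hom_ext _ (Hom.ext (NonUnitalAlgHom.ext h))

lemma asHom_congr {V : ObjectProperty (NonAssocAlgCat K)} {X Y : V.FullSubcategory}
    {f g : X ⟶ Y} (h : f = g) (x : X.obj) : asHom f x = asHom g x := by rw [h]

/-- The fibre product of two algebra maps, as a subalgebra of the product. -/
def fibreProduct {X Y Z : (models E).FullSubcategory} (f : X ⟶ Z) (g : Y ⟶ Z) :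
    NonUnitalSubalgebra K (X.obj × Y.obj) where
  carrier := {w | asHom f w.1 = asHom g w.2}
  add_mem' {a b} ha hb := by
    simp only [Set.mem_ofPred_eq, Prod.fst_add, Prod.snd_add, map_add] at *
    rw [ha, hb]
  zero_mem' := by simp
  mul_mem' {a b} ha hb := by
    simp only [Set.mem_ofPred_eq, Prod.fst_mul, Prod.snd_mul, map_mul] at *
    rw [ha, hb]
  smul_mem' c a ha := by
    simp only [Set.mem_ofPred_eq, Prod.smul_fst, Prod.smul_snd, map_smul] at *
    rw [ha]

/-- The fibre product as an object of the equational class. -/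
def fibreProductObj {X Y Z : (models E).FullSubcategory} (f : X ⟶ Z) (g : Y ⟶ Z) :
    (models E).FullSubcategory :=
  ⟨⟨fibreProduct f g⟩, models_subalgebra (A := ⟨X.obj × Y.obj⟩)
    (models_prod X.property Y.property) _⟩

/-- The first projection of the fibre product. -/
def fibreProductFst {X Y Z : (models E).FullSubcategory} (f : X ⟶ Z) (g : Y ⟶ Z) :
    fibreProductObj f g ⟶ X :=
  ofHom ((NonUnitalAlgHom.fst K X.obj Y.obj).comp
    (NonUnitalSubalgebraClass.subtype (fibreProduct f g)))

/-- The second projection of the fibre product. -/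
def fibreProductSnd {X Y Z : (models E).FullSubcategory} (f : X ⟶ Z) (g : Y ⟶ Z) :
    fibreProductObj f g ⟶ Y :=
  ofHom ((NonUnitalAlgHom.snd K X.obj Y.obj).comp
    (NonUnitalSubalgebraClass.subtype (fibreProduct f g)))

lemma fibreProduct_condition {X Y Z : (models E).FullSubcategory} (f : X ⟶ Z) (g : Y ⟶ Z) :
    fibreProductFst f g ≫ f = fibreProductSnd f g ≫ g :=
  hom_ext_apply fun w => w.2

/-- The fibre product is a pullback. -/
def fibreProductIsLimit {X Y Z : (models E).FullSubcategory} (f : X ⟶ Z) (g : Y ⟶ Z) :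
    IsLimit (PullbackCone.mk _ _ (fibreProduct_condition f g)) :=
  PullbackCone.IsLimit.mk _
    (fun s => ofHom (NonUnitalAlgHom.codRestrict
      (NonUnitalAlgHom.prod (asHom s.fst) (asHom s.snd)) (fibreProduct f g)
      (fun x => asHom_congr s.condition x)))
    (fun _ => hom_ext_apply fun _ => rfl) (fun _ => hom_ext_apply fun _ => rfl)
    fun _ _ h₁ h₂ => hom_ext_apply fun x =>
      Subtype.ext (Prod.ext (asHom_congr h₁ x) (asHom_congr h₂ x))

instance : HasPullbacks (models E).FullSubcategory :=
  have : ∀ {X Y Z : (models E).FullSubcategory} {f : X ⟶ Z} {g : Y ⟶ Z},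
      HasLimit (cospan f g) := fun {_ _ _ f g} => ⟨⟨⟨_, fibreProductIsLimit f g⟩⟩⟩
  hasPullbacks_of_hasLimit_cospan _

/-- The trivial algebra. -/
def trivialObj (E : Set (NAPoly K)) : (models E).FullSubcategory := ⟨⟨PUnit⟩, models_punit E⟩

instance : HasTerminal (models E).FullSubcategory :=
  IsTerminal.hasTerminal (X := trivialObj E) <|
    IsTerminal.ofUniqueHom (fun _ => ofHom 0) fun _ _ => hom_ext_apply fun _ => rfl

lemma hasFiniteLimits_models (E : Set (NAPoly K)) :
    HasFiniteLimits (models E).FullSubcategory :=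
  hasFiniteLimits_of_hasTerminal_and_pullbacks

/-- The comparison from the fibre product to the chosen pullback. -/
noncomputable def toPullback {X Y Z : (models E).FullSubcategory} (f : X ⟶ Z) (g : Y ⟶ Z) :
    fibreProductObj f g ⟶ pullback f g :=
  pullback.lift _ _ (fibreProduct_condition f g)

lemma fst_toPullback {X Y Z : (models E).FullSubcategory} (f : X ⟶ Z) (g : Y ⟶ Z)
    (w : fibreProduct f g) :
    asHom (pullback.fst f g) (asHom (toPullback f g) w) = w.1.1 :=
  asHom_congr (pullback.lift_fst _ _ (fibreProduct_condition f g)) w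

lemma snd_toPullback {X Y Z : (models E).FullSubcategory} (f : X ⟶ Z) (g : Y ⟶ Z)
    (w : fibreProduct f g) :
    asHom (pullback.snd f g) (asHom (toPullback f g) w) = w.1.2 :=
  asHom_congr (pullback.lift_snd _ _ (fibreProduct_condition f g)) w

lemma pullback_condition_apply {X Y Z : (models E).FullSubcategory} (f : X ⟶ Z) (g : Y ⟶ Z)
    (z : (pullback f g).obj) :
    asHom f (asHom (pullback.fst f g) z) = asHom g (asHom (pullback.snd f g) z) :=
  asHom_congr (pullback.condition (f := f) (g := g)) z

lemma toPullback_fst_snd {X Y Z : (models E).FullSubcategory} (f : X ⟶ Z) (g : Y ⟶ Z)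
    (z : (pullback f g).obj) :
    asHom (toPullback f g)
      (⟨(asHom (pullback.fst f g) z, asHom (pullback.snd f g) z),
        pullback_condition_apply f g z⟩ : fibreProduct f g) = z := by
  let k : pullback f g ⟶ fibreProductObj f g :=
    (fibreProductIsLimit f g).lift (PullbackCone.mk _ _ (pullback.condition (f := f) (g := g)))
  have h : k ≫ toPullback f g = 𝟙 _ := by
    apply pullback.hom_ext
    · exact hom_ext_apply fun x => fst_toPullback f g _
    · exact hom_ext_apply fun x => snd_toPullback f g _
  exact asHom_congr h z

/-- The pullback used by `changeOfBase` is only known up to isomorphism. The comparison with the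
concrete fibre product allows its elements to be treated as pairs. -/
lemma pullback_ext_apply {X Y Z : (models E).FullSubcategory} {f : X ⟶ Z} {g : Y ⟶ Z}
    {z z' : (pullback f g).obj}
    (h₁ : asHom (pullback.fst f g) z = asHom (pullback.fst f g) z')
    (h₂ : asHom (pullback.snd f g) z = asHom (pullback.snd f g) z') : z = z' := by
  rw [← toPullback_fst_snd f g z, ← toPullback_fst_snd f g z']
  exact congrArg (asHom (toPullback f g)) (Subtype.ext (Prod.ext h₁ h₂))

lemma point_section_apply {B : (models E).FullSubcategory} (P : PointOver B)
    (b : B.obj) : asHom P.π (asHom P.σ b) = b := asHom_congr P.section_comp b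

variable {A B : (models E).FullSubcategory} (a : A ⟶ B)

lemma fst_changeOfBase_section (P : PointOver B) (x : A.obj) :
    asHom (pullback.fst a P.π) (asHom ((PointOver.changeOfBase a).obj P).σ x) = x :=
  asHom_congr ((PointOver.changeOfBase a).obj P).section_comp x

lemma snd_changeOfBase_section (P : PointOver B) (x : A.obj) :
    asHom (pullback.snd a P.π) (asHom ((PointOver.changeOfBase a).obj P).σ x) =
      asHom P.σ (asHom a x) :=
  asHom_congr (pullback.lift_snd (𝟙 A) (a ≫ P.σ) (by simp [P.section_comp])) x

lemma fst_changeOfBase_map {P P' : PointOver B} (h : P ⟶ P') (z : (pullback a P.π).obj) :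
    asHom (pullback.fst a P'.π) (asHom ((PointOver.changeOfBase a).map h).f z) =
      asHom (pullback.fst a P.π) z :=
  asHom_congr ((PointOver.changeOfBase a).map h).comp_π z

lemma snd_changeOfBase_map {P P' : PointOver B} (h : P ⟶ P') (z : (pullback a P.π).obj) :
    asHom (pullback.snd a P'.π) (asHom ((PointOver.changeOfBase a).map h).f z) =
      asHom h.f (asHom (pullback.snd a P.π) z) :=
  asHom_congr (pullback.lift_snd (pullback.fst a P.π) (pullback.snd a P.π ≫ h.f)
    (by rw [Category.assoc, h.comp_π, pullback.condition])) z

/-- An element of the kernel as an element of the fibre product. -/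
def kernelElement {P : PointOver B} {k : P.X.obj} (hk : asHom P.π k = 0) : fibreProduct a P.π :=
  ⟨(0, k), (map_zero (asHom a)).trans hk.symm⟩

end Category

end NonAssocAlgCat

/-! ### Lie multiplications -/

/-- The multiplication is alternating and satisfies the Jacobi identity. -/
structure IsLieMul (A : Type*) [NonUnitalNonAssocRing A] : Prop where
  mul_self (x : A) : x * x = 0
  jacobi (x y z : A) : x * (y * z) + z * (x * y) + y * (z * x) = 0

lemma mul_eq_neg_of_mul_self {A : Type*} [NonUnitalNonAssocRing A]
    (h : ∀ x : A, x * x = 0) (x y : A) : x * y = -(y * x) := by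
  have := h (x + y)
  rw [mul_add, add_mul, add_mul, h, h, zero_add, add_zero] at this
  exact eq_neg_of_add_eq_zero_right this

/-- Jacobi in derivation form: left multiplication by `x` obeys the Leibniz rule. The construction
below uses this form. -/
lemma IsLieMul.mul_mul {A : Type*} [NonUnitalNonAssocRing A] (h : IsLieMul A) (x y z : A) :
    x * (y * z) = x * y * z + y * (x * z) := by
  have := h.jacobi x y z
  rw [mul_eq_neg_of_mul_self h.mul_self z (x * y), mul_eq_neg_of_mul_self h.mul_self z x,
    mul_neg, ← sub_eq_add_neg, ← sub_eq_add_neg, sub_sub, sub_eq_zero] at this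
  exact this

namespace NonAssocAlgCat

variable {K : Type u} [Field K]

lemma satisfies_square_iff (A : NonAssocAlgCat K) :
    A.Satisfies (NAPoly.square K) ↔ ∀ x : A, x * x = 0 := by
  simp only [Satisfies, NAPoly.square, NAPoly.x, map_mul,
    FreeNonUnitalNonAssocAlgebra.lift_of_apply]
  exact ⟨fun h x => h fun _ => x, fun h e => h _⟩

lemma satisfies_jacobi_iff (A : NonAssocAlgCat K) :
    A.Satisfies (NAPoly.jacobi K) ↔
      ∀ x y z : A, x * (y * z) + z * (x * y) + y * (z * x) = 0 := by
  simp only [Satisfies, NAPoly.jacobi, NAPoly.x, map_mul, map_add,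
    FreeNonUnitalNonAssocAlgebra.lift_of_apply]
  exact ⟨fun h x y z => h fun n => if n = 0 then x else if n = 1 then y else z, fun h e => h _ _ _⟩

lemma alternating_iff (A : NonAssocAlgCat K) : alternating K A ↔ ∀ x : A, x * x = 0 := by
  simp [alternating, models, satisfies_square_iff]

lemma lie_iff (A : NonAssocAlgCat K) : lie K A ↔ IsLieMul A := by
  simp only [lie, models, Set.mem_insert_iff, Set.mem_singleton_iff, forall_eq_or_imp, forall_eq,
    satisfies_square_iff, satisfies_jacobi_iff]
  exact ⟨fun h => ⟨h.1, h.2⟩, fun h => ⟨h.1, h.2⟩⟩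

end NonAssocAlgCat

/-! ### Coinduction of Lie algebras with an action -/

namespace Coinduction

section Words

variable {B Y : Type*}

/-- The operator `(D_b φ)(l) = φ(b :: l)` on functions of words. -/
def shift (b : B) (φ : List B → Y) : List B → Y := fun l => φ (b :: l)

/-- The operator `(D_l φ)(l') = φ(l ++ l')` on functions of words. -/
def shifts (l : List B) (φ : List B → Y) : List B → Y := fun l' => φ (l ++ l')

lemma shift_smul {K : Type*} [SMul K Y] (k : K) (b : B) (φ : List B → Y) :
    shift b (k • φ) = k • shift b φ := rfl

variable [NonUnitalNonAssocRing Y]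

lemma shift_add (b : B) (φ ψ : List B → Y) : shift b (φ + ψ) = shift b φ + shift b ψ := rfl

lemma shift_sub (b : B) (φ ψ : List B → Y) : shift b (φ - ψ) = shift b φ - shift b ψ := rfl

/-- The convolution product with respect to the unshuffle coproduct on words: it extends the
product of the values at the empty word so that every `D_b` becomes a derivation. -/
def conv (φ ψ : List B → Y) : List B → Y
  | [] => φ [] * ψ []
  | b :: l => conv (shift b φ) ψ l + conv φ (shift b ψ) l

lemma conv_nil (φ ψ : List B → Y) : conv φ ψ [] = φ [] * ψ [] := rfl

lemma conv_cons (φ ψ : List B → Y) (b : B) (l : List B) :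
    conv φ ψ (b :: l) = conv (shift b φ) ψ l + conv φ (shift b ψ) l := rfl

lemma shift_conv (b : B) (φ ψ : List B → Y) :
    shift b (conv φ ψ) = conv (shift b φ) ψ + conv φ (shift b ψ) := rfl

lemma conv_add_left (φ φ' ψ : List B → Y) : conv (φ + φ') ψ = conv φ ψ + conv φ' ψ := by
  funext l
  induction l generalizing φ φ' ψ with
  | nil => exact add_mul _ _ _
  | cons b l ih =>
    simp only [Pi.add_apply, conv_cons, shift_add] at ih ⊢
    rw [ih, ih]
    abel

lemma conv_add_right (φ ψ ψ' : List B → Y) : conv φ (ψ + ψ') = conv φ ψ + conv φ ψ' := by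
  funext l
  induction l generalizing φ ψ ψ' with
  | nil => exact mul_add _ _ _
  | cons b l ih =>
    simp only [Pi.add_apply, conv_cons, shift_add] at ih ⊢
    rw [ih, ih]
    abel

lemma conv_smul_left {K : Type*} [Field K] [Module K Y] [IsScalarTower K Y Y] (k : K)
    (φ ψ : List B → Y) : conv (k • φ) ψ = k • conv φ ψ := by
  funext l
  induction l generalizing φ ψ with
  | nil => exact smul_mul_assoc _ _ _
  | cons b l ih =>
    simp only [Pi.smul_apply, conv_cons, shift_smul] at ih ⊢
    rw [ih, ih, smul_add]

lemma conv_smul_right {K : Type*} [Field K] [Module K Y] [SMulCommClass K Y Y] (k : K)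
    (φ ψ : List B → Y) : conv φ (k • ψ) = k • conv φ ψ := by
  funext l
  induction l generalizing φ ψ with
  | nil => exact mul_smul_comm _ _ _
  | cons b l ih =>
    simp only [Pi.smul_apply, conv_cons, shift_smul] at ih ⊢
    rw [ih, ih, smul_add]

lemma conv_zero_left (ψ : List B → Y) : conv 0 ψ = 0 := by
  simpa using conv_add_left 0 0 ψ

lemma conv_zero_right (φ : List B → Y) : conv φ 0 = 0 := by
  simpa using conv_add_right φ 0 0

lemma conv_sub_left (φ φ' ψ : List B → Y) : conv (φ - φ') ψ = conv φ ψ - conv φ' ψ := by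
  rw [eq_sub_iff_add_eq, ← conv_add_left, sub_add_cancel]

lemma conv_sub_right (φ ψ ψ' : List B → Y) : conv φ (ψ - ψ') = conv φ ψ - conv φ ψ' := by
  rw [eq_sub_iff_add_eq, ← conv_add_right, sub_add_cancel]

lemma conv_self (hY : ∀ y : Y, y * y = 0) (φ : List B → Y) : conv φ φ = 0 := by
  funext l
  induction l generalizing φ with
  | nil => exact hY _
  | cons b l ih =>
    -- Polarisation: the two terms of the recursion are the mixed terms in the square of `shift b φ
    -- + φ`.
    have h := ih (shift b φ + φ)
    rw [conv_add_left, conv_add_right, conv_add_right] at h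
    simpa only [conv_cons, Pi.add_apply, Pi.zero_apply, ih, zero_add, add_zero] using h

lemma conv_swap (hY : ∀ y : Y, y * y = 0) (φ ψ : List B → Y) : conv φ ψ = -conv ψ φ := by
  have h := conv_self hY (φ + ψ)
  rw [conv_add_left, conv_add_right, conv_add_right, conv_self hY, conv_self hY, zero_add,
    add_zero] at h
  exact eq_neg_of_add_eq_zero_left h

/-- At the empty word this is the Leibniz rule in `Y`. It propagates to longer words because each
`D_b` is a derivation, so applying it to both sides yields three instances for shorter words. -/
lemma conv_conv (hY : IsLieMul Y) (φ ψ χ : List B → Y) :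
    conv φ (conv ψ χ) = conv (conv φ ψ) χ + conv ψ (conv φ χ) := by
  funext l
  induction l generalizing φ ψ χ with
  | nil => exact hY.mul_mul _ _ _
  | cons b l ih =>
    simp only [Pi.add_apply, conv_cons, shift_conv, conv_add_left, conv_add_right] at ih ⊢
    rw [ih (shift b φ) ψ χ, ih φ (shift b ψ) χ, ih φ ψ (shift b χ)]
    abel

lemma conv_jacobi (hY : IsLieMul Y) (φ ψ χ : List B → Y) :
    conv φ (conv ψ χ) + conv χ (conv φ ψ) + conv ψ (conv χ φ) = 0 := by
  rw [conv_conv hY φ ψ χ, conv_swap hY.mul_self (conv φ ψ) χ, conv_swap hY.mul_self χ φ,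
    show -conv φ χ = 0 - conv φ χ from (zero_sub _).symm, conv_sub_right, conv_zero_right]
  abel

end Words

variable {K : Type*} [Field K]
variable {A B Y : Type*}
variable [NonUnitalNonAssocRing A] [Module K A]
variable [NonUnitalNonAssocRing B] [Module K B]
variable [NonUnitalNonAssocRing Y] [Module K Y]

/-- The conditions that make `b ↦ D_b` an action at `φ`, and evaluation at the empty word an
equivariant map to the kernel of `p`. -/
def compatible [IsScalarTower K Y Y] [SMulCommClass K Y Y]
    (a : A →ₙₐ[K] B) (p : Y →ₙₐ[K] A) (s : A →ₙₐ[K] Y) :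
    Submodule K (List B → Y) where
  carrier := {φ | (∀ b c, shift (b + c) φ = shift b φ + shift c φ) ∧
    (∀ (k : K) b, shift (k • b) φ = k • shift b φ) ∧
    (∀ b c, shift (b * c) φ = shift b (shift c φ) - shift c (shift b φ)) ∧
    p (φ []) = 0 ∧ ∀ x, φ [a x] = s x * φ []}
  add_mem' {φ ψ} := by
    rintro ⟨h₁, h₂, h₃, h₄, h₅⟩ ⟨h₁', h₂', h₃', h₄', h₅'⟩
    refine ⟨fun b c => ?_, fun k b => ?_, fun b c => ?_, ?_, fun x => ?_⟩
    · simp only [shift_add, h₁, h₁']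
      abel
    · simp only [shift_add, h₂, h₂', smul_add]
    · simp only [shift_add, h₃, h₃']
      abel
    · rw [Pi.add_apply, map_add, h₄, h₄', add_zero]
    · rw [Pi.add_apply, Pi.add_apply, h₅, h₅', mul_add]
  zero_mem' := by
    refine ⟨fun b c => ?_, fun k b => ?_, fun b c => ?_, ?_, fun x => ?_⟩
    · exact (add_zero _).symm
    · exact (smul_zero k).symm
    · exact (sub_zero _).symm
    · exact map_zero p
    · exact (mul_zero _).symm
  smul_mem' k φ := by
    rintro ⟨h₁, h₂, h₃, h₄, h₅⟩
    refine ⟨fun b c => ?_, fun k' b => ?_, fun b c => ?_, ?_, fun x => ?_⟩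
    · simp only [shift_smul, h₁, smul_add]
    · rw [shift_smul, shift_smul, h₂, smul_comm]
    · simp only [shift_smul, h₃, smul_sub]
    · rw [Pi.smul_apply, map_smul, h₄, smul_zero]
    · rw [Pi.smul_apply, Pi.smul_apply, h₅, mul_smul_comm]

variable [IsScalarTower K Y Y] [SMulCommClass K Y Y]
variable (a : A →ₙₐ[K] B) (p : Y →ₙₐ[K] A) (s : A →ₙₐ[K] Y)

/-- The coinduced module: the largest space of functions of words that is stable under the
operators `D_b` and consists of compatible functions. -/
def coinduced : Submodule K (List B → Y) where
  carrier := {φ | ∀ l, shifts l φ ∈ compatible a p s}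
  add_mem' h h' l := (compatible a p s).add_mem (h l) (h' l)
  zero_mem' _ := (compatible a p s).zero_mem
  smul_mem' k _ h l := (compatible a p s).smul_mem k (h l)

variable {a p s}

lemma compatible_of_mem {φ : List B → Y} (h : φ ∈ coinduced a p s) : φ ∈ compatible a p s :=
  h []

lemma shift_mem {φ : List B → Y} (h : φ ∈ coinduced a p s) (b : B) :
    shift b φ ∈ coinduced a p s := fun l => h (b :: l)

lemma conv_compatible (hY : IsLieMul Y) {φ ψ : List B → Y} (hφ : φ ∈ compatible a p s)
    (hψ : ψ ∈ compatible a p s) : conv φ ψ ∈ compatible a p s := by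
  obtain ⟨h₁, h₂, h₃, h₄, h₅⟩ := hφ
  obtain ⟨h₁', h₂', h₃', h₄', h₅'⟩ := hψ
  refine ⟨fun b c => ?_, fun k b => ?_, fun b c => ?_, ?_, fun x => ?_⟩
  · simp only [shift_conv, h₁, h₁', conv_add_left, conv_add_right]
    abel
  · simp only [shift_conv, h₂, h₂', conv_smul_left, conv_smul_right, smul_add]
  · simp only [shift_conv, shift_add, h₃, h₃', conv_sub_left, conv_sub_right]
    abel
  · rw [conv_nil, map_mul, h₄, zero_mul]
  -- On a one-letter word the recursion for `conv` is a Leibniz rule, matching the one for left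
  -- multiplication by `s x` in `Y`.
  · rw [conv_cons, conv_nil, conv_nil, conv_nil, hY.mul_mul, ← h₅, ← h₅']
    rfl

lemma conv_mem (hY : IsLieMul Y) {φ ψ : List B → Y} (hφ : φ ∈ coinduced a p s)
    (hψ : ψ ∈ coinduced a p s) : conv φ ψ ∈ coinduced a p s := by
  intro l
  induction l generalizing φ ψ with
  | nil => exact conv_compatible hY (compatible_of_mem hφ) (compatible_of_mem hψ)
  | cons b l ih =>
    exact (compatible a p s).add_mem (ih (shift_mem hφ b) hψ) (ih hφ (shift_mem hψ b))

variable (a p s) in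
/-- The semidirect sum of `B` and the coinduced module. -/
@[ext]
structure SemidirectSum (hY : IsLieMul Y) where
  /-- The component in the acting algebra. -/
  base : B
  /-- The component in the coinduced module. -/
  fibre : coinduced a p s

namespace SemidirectSum

variable {hY : IsLieMul Y}

/-- The underlying additive structure is that of the product. -/
def equivProd : SemidirectSum a p s hY ≃ B × coinduced a p s where
  toFun x := (x.base, x.fibre)
  invFun x := ⟨x.1, x.2⟩

instance : AddCommGroup (SemidirectSum a p s hY) := equivProd.addCommGroup

instance : Module K (SemidirectSum a p s hY) := equivProd.module K

instance : Mul (SemidirectSum a p s hY) where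
  mul x y := ⟨x.base * y.base,
    ⟨shift x.base y.fibre - shift y.base x.fibre + conv x.fibre y.fibre,
      add_mem (sub_mem (shift_mem y.fibre.2 _) (shift_mem x.fibre.2 _))
        (conv_mem hY x.fibre.2 y.fibre.2)⟩⟩

variable (x y : SemidirectSum a p s hY)

@[simp] lemma base_zero : (0 : SemidirectSum a p s hY).base = 0 := rfl
@[simp] lemma fibre_zero : (0 : SemidirectSum a p s hY).fibre = 0 := rfl
@[simp] lemma base_add : (x + y).base = x.base + y.base := rfl
@[simp] lemma fibre_add : (x + y).fibre = x.fibre + y.fibre := rfl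
@[simp] lemma base_smul (k : K) : (k • x).base = k • x.base := rfl
@[simp] lemma fibre_smul (k : K) : (k • x).fibre = k • x.fibre := rfl
@[simp] lemma base_mul : (x * y).base = x.base * y.base := rfl

lemma fibre_mul : ((x * y).fibre : List B → Y) =
    shift x.base y.fibre - shift y.base x.fibre + conv (x.fibre : List B → Y) y.fibre := rfl

variable {x y} in
lemma ext_coe (h₁ : x.base = y.base) (h₂ : (x.fibre : List B → Y) = y.fibre) : x = y :=
  SemidirectSum.ext h₁ (Subtype.ext h₂)

lemma shift_base_add (b c : B) (φ : coinduced a p s) :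
    shift (b + c) (φ : List B → Y) = shift b φ + shift c φ := (compatible_of_mem φ.2).1 b c

lemma shift_base_smul (k : K) (b : B) (φ : coinduced a p s) :
    shift (k • b) (φ : List B → Y) = k • shift b φ := (compatible_of_mem φ.2).2.1 k b

lemma shift_base_mul (b c : B) (φ : coinduced a p s) :
    shift (b * c) (φ : List B → Y) = shift b (shift c φ) - shift c (shift b φ) :=
  (compatible_of_mem φ.2).2.2.1 b c

lemma shift_base_zero (φ : coinduced a p s) : shift 0 (φ : List B → Y) = 0 := by
  simpa using shift_base_add 0 0 φ

lemma map_fibre_nil (φ : coinduced a p s) : p ((φ : List B → Y) []) = 0 :=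
  (compatible_of_mem φ.2).2.2.2.1

lemma fibre_singleton (φ : coinduced a p s) (x : A) :
    (φ : List B → Y) [a x] = s x * (φ : List B → Y) [] := (compatible_of_mem φ.2).2.2.2.2 x

instance : NonUnitalNonAssocRing (SemidirectSum a p s hY) where
  left_distrib x y z := by
    refine ext_coe (mul_add _ _ _) ?_
    simp only [fibre_mul, fibre_add, base_add, Submodule.coe_add, shift_base_add, shift_add,
      conv_add_right]
    abel
  right_distrib x y z := by
    refine ext_coe (add_mul _ _ _) ?_
    simp only [fibre_mul, fibre_add, base_add, Submodule.coe_add, shift_base_add, shift_add,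
      conv_add_left]
    abel
  zero_mul x := by
    refine ext_coe (zero_mul _) ?_
    rw [fibre_mul, base_zero, shift_base_zero, fibre_zero, Submodule.coe_zero, conv_zero_left]
    exact (add_zero _).trans (sub_zero _)
  mul_zero x := by
    refine ext_coe (mul_zero _) ?_
    rw [fibre_mul, base_zero, shift_base_zero, fibre_zero, Submodule.coe_zero, conv_zero_right]
    exact (add_zero _).trans (sub_zero _)

instance [IsScalarTower K B B] :
    IsScalarTower K (SemidirectSum a p s hY) (SemidirectSum a p s hY) where
  smul_assoc k x y := by
    refine ext_coe (smul_mul_assoc k x.base y.base) ?_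
    simp only [smul_eq_mul, fibre_mul, fibre_smul, base_smul, Submodule.coe_smul,
      shift_base_smul, shift_smul, conv_smul_left, smul_add, smul_sub]

instance [SMulCommClass K B B] :
    SMulCommClass K (SemidirectSum a p s hY) (SemidirectSum a p s hY) where
  smul_comm k x y := by
    refine ext_coe (mul_smul_comm k x.base y.base).symm ?_
    simp only [smul_eq_mul, fibre_mul, fibre_smul, base_smul, Submodule.coe_smul,
      shift_base_smul, shift_smul, conv_smul_right, smul_add, smul_sub]

lemma isLieMul (hB : IsLieMul B) : IsLieMul (SemidirectSum a p s hY) where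
  mul_self x := by
    refine ext_coe (hB.mul_self _) ?_
    rw [fibre_mul, conv_self hY.mul_self, sub_self, zero_add]
    rfl
  jacobi x y z := by
    refine ext_coe (hB.jacobi _ _ _) ?_
    simp only [fibre_mul, fibre_add, Submodule.coe_add, base_mul, shift_base_mul, shift_add,
      shift_sub, shift_conv, conv_add_right, conv_sub_right, fibre_zero, Submodule.coe_zero]
    -- The second-order terms in `D` cancel through the action of brackets. Anticommutativity of
    -- `conv` aligns the mixed terms so that they cancel too, leaving the Jacobi sum of the three
    -- fibre components.
    rw [conv_swap hY.mul_self (shift x.base y.fibre) z.fibre,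
      conv_swap hY.mul_self (shift z.base x.fibre) y.fibre,
      conv_swap hY.mul_self (shift y.base z.fibre) x.fibre,
      ← conv_jacobi hY (x.fibre : List B → Y) y.fibre z.fibre]
    abel

end SemidirectSum

end Coinduction

/-! ### Universal property of the semidirect sum. -/

namespace Coinduction

variable {K : Type*} [Field K]
variable {A B Y X : Type*}
variable [NonUnitalNonAssocRing A] [Module K A]
variable [NonUnitalNonAssocRing B] [Module K B]
variable [NonUnitalNonAssocRing Y] [Module K Y]
variable [NonUnitalNonAssocRing X] [Module K X]

namespace SemidirectSum

variable [IsScalarTower K Y Y] [SMulCommClass K Y Y]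
variable (a : A →ₙₐ[K] B) (p : Y →ₙₐ[K] A) (s : A →ₙₐ[K] Y) (hY : IsLieMul Y)

/-- The projection of the semidirect sum to the acting algebra. -/
def baseHom : SemidirectSum a p s hY →ₙₐ[K] B where
  toFun := base
  map_smul' _ _ := rfl
  map_zero' := rfl
  map_add' _ _ := rfl
  map_mul' _ _ := rfl

/-- The inclusion of the acting algebra in the semidirect sum. -/
def inclHom : B →ₙₐ[K] SemidirectSum a p s hY where
  toFun b := ⟨b, 0⟩
  map_smul' k _ := ext_coe rfl (smul_zero k).symm
  map_zero' := rfl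
  map_add' _ _ := ext_coe rfl (add_zero _).symm
  map_mul' b c := by
    refine ext_coe rfl ?_
    rw [fibre_mul, Submodule.coe_zero, conv_zero_left]
    exact ((add_zero _).trans (sub_zero _)).symm

end SemidirectSum

/-- The function `l ↦ θ(l · k)` of words, where words in `B` act on `X` through `σ`. -/
def orbit (σ : B → X) (θ : X → Y) (k : X) : List B → Y
  | [] => θ k
  | b :: l => orbit σ θ (σ b * k) l

section Orbit

variable (σ : B →ₙₐ[K] X) (θ : X →ₗ[K] Y)

lemma shift_orbit (b : B) (k : X) : shift b (orbit σ θ k) = orbit σ θ (σ b * k) := rfl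

lemma orbit_add (k k' : X) : orbit σ θ (k + k') = orbit σ θ k + orbit σ θ k' := by
  funext l
  induction l generalizing k k' with
  | nil => exact map_add θ _ _
  | cons b l ih =>
    change orbit σ θ (σ b * (k + k')) l = orbit σ θ (σ b * k) l + orbit σ θ (σ b * k') l
    rw [mul_add, ih]
    rfl

lemma orbit_smul [SMulCommClass K X X] (c : K) (k : X) :
    orbit σ θ (c • k) = c • orbit σ θ k := by
  funext l
  induction l generalizing k with
  | nil => exact map_smul θ _ _
  | cons b l ih =>
    change orbit σ θ (σ b * (c • k)) l = c • orbit σ θ (σ b * k) l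
    rw [mul_smul_comm, ih]
    rfl

lemma orbit_zero : orbit σ θ 0 = 0 := by
  simpa using orbit_add σ θ 0 0

lemma orbit_neg (k : X) : orbit σ θ (-k) = -orbit σ θ k := by
  rw [eq_neg_iff_add_eq_zero, ← orbit_add, neg_add_cancel, orbit_zero]

lemma orbit_sub (k k' : X) : orbit σ θ (k - k') = orbit σ θ k - orbit σ θ k' := by
  rw [sub_eq_add_neg, orbit_add, orbit_neg, sub_eq_add_neg]

end Orbit

/-- The data of a point `(π, σ)` over `B` with a morphism of points from its change of base along
`a` to `(p, s)`, where the latter is given by its restriction `θ` to the kernel of `π`. -/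
structure KernelMap (a : A →ₙₐ[K] B) (p : Y →ₙₐ[K] A) (s : A →ₙₐ[K] Y)
    (π : X →ₙₐ[K] B) (σ : B →ₙₐ[K] X) (θ : X →ₗ[K] Y) : Prop where
  map_section (b : B) : π (σ b) = b
  map_mul (k k' : X) : π k = 0 → π k' = 0 → θ (k * k') = θ k * θ k'
  map_act (x : A) (k : X) : π k = 0 → θ (σ (a x) * k) = s x * θ k
  map_map (k : X) : π k = 0 → p (θ k) = 0

namespace KernelMap

variable {a : A →ₙₐ[K] B} {p : Y →ₙₐ[K] A} {s : A →ₙₐ[K] Y}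
variable {π : X →ₙₐ[K] B} {σ : B →ₙₐ[K] X} {θ : X →ₗ[K] Y}

lemma map_section_mul {k : X} (hk : π k = 0) (b : B) : π (σ b * k) = 0 := by
  rw [_root_.map_mul, hk, mul_zero]

/-- Left multiplication by `σ b` is a derivation of `X` preserving the kernel, so orbits of products
obey the recursion that defines `conv`. -/
lemma orbit_mul (h : KernelMap a p s π σ θ) (hX : IsLieMul X) {k k' : X} (hk : π k = 0)
    (hk' : π k' = 0) : orbit σ θ (k * k') = conv (orbit σ θ k) (orbit σ θ k') := by
  funext l
  induction l generalizing k k' with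
  | nil => exact h.map_mul _ _ hk hk'
  | cons b l ih =>
    change orbit σ θ (σ b * (k * k')) l = _
    rw [hX.mul_mul, orbit_add, Pi.add_apply, ih (map_section_mul hk b) hk',
      ih hk (map_section_mul hk' b)]
    rfl

lemma map_sub_section (h : KernelMap a p s π σ θ) (w : X) : π (w - σ (π w)) = 0 := by
  rw [map_sub, h.map_section, sub_self]

variable [IsScalarTower K Y Y] [SMulCommClass K Y Y]

lemma orbit_compatible [IsScalarTower K X X] [SMulCommClass K X X]
    (h : KernelMap a p s π σ θ) (hX : IsLieMul X) {k : X} (hk : π k = 0) :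
    orbit σ θ k ∈ compatible a p s := by
  refine ⟨fun b c => ?_, fun r b => ?_, fun b c => ?_, h.map_map _ hk, fun x => h.map_act x k hk⟩
  · simp only [shift_orbit, map_add, add_mul, orbit_add]
  · simp only [shift_orbit, map_smul, smul_mul_assoc, orbit_smul]
  · simp only [shift_orbit, _root_.map_mul]
    rw [hX.mul_mul (σ b) (σ c) k, orbit_add, add_sub_cancel_right]

lemma orbit_mem [IsScalarTower K X X] [SMulCommClass K X X]
    (h : KernelMap a p s π σ θ) (hX : IsLieMul X) {k : X} (hk : π k = 0) :
    orbit σ θ k ∈ coinduced a p s := by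
  intro l
  induction l generalizing k with
  | nil => exact h.orbit_compatible hX hk
  | cons b l ih => exact ih (map_section_mul hk b)

open SemidirectSum

/-- The morphism to the semidirect sum that corresponds to a morphism out of the change of
base. -/
def toSemidirectSum [IsScalarTower K X X] [SMulCommClass K X X]
    (h : KernelMap a p s π σ θ) (hX : IsLieMul X) (hY : IsLieMul Y) :
    X →ₙₐ[K] SemidirectSum a p s hY where
  toFun w := ⟨π w, ⟨orbit σ θ (w - σ (π w)), h.orbit_mem hX (h.map_sub_section w)⟩⟩
  map_smul' c w := ext_coe (map_smul π c w) <| by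
    change orbit σ θ (c • w - σ (π (c • w))) = c • orbit σ θ (w - σ (π w))
    rw [map_smul, map_smul, ← smul_sub, orbit_smul]
  map_zero' := ext_coe (map_zero π) <| by
    change orbit σ θ (0 - σ (π 0)) = 0
    rw [map_zero, map_zero, sub_zero, orbit_zero]
  map_add' w w' := ext_coe (map_add π w w') <| by
    change orbit σ θ (w + w' - σ (π (w + w'))) =
      orbit σ θ (w - σ (π w)) + orbit σ θ (w' - σ (π w'))
    rw [map_add, map_add, add_sub_add_comm, orbit_add]
  map_mul' w w' := ext_coe (_root_.map_mul π w w') <| by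
    rw [fibre_mul]
    change orbit σ θ (w * w' - σ (π (w * w'))) =
      shift (π w) (orbit σ θ (w' - σ (π w'))) - shift (π w') (orbit σ θ (w - σ (π w))) +
        conv (orbit σ θ (w - σ (π w))) (orbit σ θ (w' - σ (π w')))
    rw [← h.orbit_mul hX (h.map_sub_section w) (h.map_sub_section w'), shift_orbit, shift_orbit,
      ← orbit_sub, ← orbit_add, _root_.map_mul, _root_.map_mul]
    -- What is left is the multiplication of `X` written in the decomposition into the kernel of `π`
    -- and the image of `σ`; it only needs anticommutativity.
    congr 1
    simp only [mul_sub, sub_mul, mul_eq_neg_of_mul_self hX.mul_self (σ (π w')) w,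
      mul_eq_neg_of_mul_self hX.mul_self (σ (π w')) (σ (π w))]
    abel

lemma toSemidirectSum_section [IsScalarTower K X X] [SMulCommClass K X X]
    (h : KernelMap a p s π σ θ) (hX : IsLieMul X) (hY : IsLieMul Y) (b : B) :
    h.toSemidirectSum hX hY (σ b) = inclHom a p s hY b := by
  refine ext_coe (h.map_section b) ?_
  change orbit σ θ (σ b - σ (π (σ b))) = 0
  rw [h.map_section, sub_self, orbit_zero]

/-- Multiplication by `inclHom b` acts on fibres as `D_b`. Hence the value of the fibre of `f k` at
`b :: l` is that of `f (σ b * k)` at `l`, and by induction everything is determined by values at the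
empty word, which `θ` prescribes. -/
lemma eq_toSemidirectSum [IsScalarTower K X X] [SMulCommClass K X X]
    (h : KernelMap a p s π σ θ) (hX : IsLieMul X) (hY : IsLieMul Y)
    (f : X →ₙₐ[K] SemidirectSum a p s hY) (hπ : ∀ w, (f w).base = π w)
    (hσ : ∀ b, f (σ b) = inclHom a p s hY b)
    (hθ : ∀ k, π k = 0 → ((f k).fibre : List B → Y) [] = θ k) :
    f = h.toSemidirectSum hX hY := by
  have key : ∀ (l : List B) (k : X), π k = 0 →
      ((f k).fibre : List B → Y) l = orbit σ θ k l := by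
    intro l
    induction l with
    | nil => exact hθ
    | cons b l ih =>
      intro k hk
      change _ = orbit σ θ (σ b * k) l
      rw [← ih _ (map_section_mul hk b), _root_.map_mul, hσ, fibre_mul, hπ, hk, shift_base_zero]
      change _ = (shift b ((f k).fibre : List B → Y) - 0 +
        conv (0 : List B → Y) ((f k).fibre : List B → Y)) l
      rw [conv_zero_left, sub_zero, add_zero]
      rfl
  ext1 w
  refine ext_coe (hπ w) ?_
  have hw : w = (w - σ (π w)) + σ (π w) := (sub_add_cancel _ _).symm
  change _ = orbit σ θ (w - σ (π w))
  rw [hw, map_add, hσ, fibre_add, Submodule.coe_add, ← hw]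
  refine (add_zero _).trans ?_
  exact funext fun l => key l _ (h.map_sub_section w)

end KernelMap

end Coinduction

/-! ### The right adjoint to change of base for Lie algebras. -/

namespace NonAssocAlgCat

open Coinduction SemidirectSum

variable {K : Type u} [Field K]

variable (K) in
/-- The laws of Lie algebras. -/
abbrev lieLaws : Set (NAPoly K) := {NAPoly.square K, NAPoly.jacobi K}

lemma isLieMul_obj (X : (models (lieLaws K)).FullSubcategory) : IsLieMul X.obj :=
  (lie_iff X.obj).1 X.property

variable {A B : (models (lieLaws K)).FullSubcategory} (a : A ⟶ B) (Q : PointOver A)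

/-- The point over `B` coinduced from a point over `A`. -/
def coinducedPoint : PointOver B where
  X := ⟨⟨SemidirectSum (asHom a) (asHom Q.π) (asHom Q.σ) (isLieMul_obj Q.X)⟩,
    (lie_iff _).2 (SemidirectSum.isLieMul (isLieMul_obj B))⟩
  π := ofHom (baseHom _ _ _ _)
  σ := ofHom (inclHom _ _ _ _)
  section_comp := hom_ext_apply fun _ => rfl

/-- The underlying map of the counit of coinduction. -/
noncomputable def coinducedCounitHom :
    (pullback a (coinducedPoint a Q).π).obj →ₙₐ[K] Q.X.obj :=
  let x (z : (pullback a (coinducedPoint a Q).π).obj) : A.obj :=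
    asHom (pullback.fst a (coinducedPoint a Q).π) z
  let e (z : (pullback a (coinducedPoint a Q).π).obj) :
    SemidirectSum (asHom a) (asHom Q.π) (asHom Q.σ) (isLieMul_obj Q.X) :=
    asHom (pullback.snd a (coinducedPoint a Q).π) z
  { toFun z := asHom Q.σ (x z) + ((e z).fibre : List B.obj → Q.X.obj) []
    map_smul' c z := by
      have h₁ : x (c • z) = c • x z := map_smul _ c z
      have h₂ : e (c • z) = c • e z := map_smul (asHom (pullback.snd a _)) c z
      rw [h₁, h₂, map_smul, fibre_smul, Submodule.coe_smul, Pi.smul_apply]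
      exact (smul_add _ _ _).symm
    map_zero' := by
      have h₁ : x 0 = 0 := map_zero _
      have h₂ : e 0 = 0 := map_zero (asHom (pullback.snd a _))
      rw [h₁, h₂, map_zero, fibre_zero]
      exact add_zero _
    map_add' z z' := by
      have h₁ : x (z + z') = x z + x z' := map_add _ z z'
      have h₂ : e (z + z') = e z + e z' := map_add (asHom (pullback.snd a _)) z z'
      rw [h₁, h₂, map_add, fibre_add, Submodule.coe_add, Pi.add_apply, add_add_add_comm]
    map_mul' z z' := by
      have h₁ : x (z * z') = x z * x z' := map_mul _ z z'
      have h₂ : e (z * z') = e z * e z' := map_mul (asHom (pullback.snd a _)) z z'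
      have h : ∀ z, (e z).base = asHom a (x z) :=
        fun z => (pullback_condition_apply a (coinducedPoint a Q).π z).symm
      rw [h₁, h₂, map_mul, fibre_mul, h, h]
      change _ + (((e z').fibre : List B.obj → Q.X.obj) [asHom a (x z)] -
        ((e z).fibre : List B.obj → Q.X.obj) [asHom a (x z')] +
        ((e z).fibre : List B.obj → Q.X.obj) [] * ((e z').fibre : List B.obj → Q.X.obj) []) = _
      -- Equivariance enters here: a value at the letter `a x` is the product of `Q.σ x` with the
      -- value at the empty word.
      rw [fibre_singleton, fibre_singleton, mul_add, add_mul, add_mul,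
        mul_eq_neg_of_mul_self (isLieMul_obj Q.X).mul_self (asHom Q.σ (x z'))]
      abel }

lemma coinducedCounitHom_apply (z : (pullback a (coinducedPoint a Q).π).obj) :
    coinducedCounitHom a Q z =
      asHom Q.σ (asHom (pullback.fst a (coinducedPoint a Q).π) z) +
        (SemidirectSum.fibre (asHom (pullback.snd a (coinducedPoint a Q).π) z) :
          List B.obj → Q.X.obj) [] := rfl

/-- The counit of coinduction. -/
noncomputable def coinducedCounit :
    (PointOver.changeOfBase a).obj (coinducedPoint a Q) ⟶ Q where
  f := ofHom (coinducedCounitHom a Q)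
  comp_π := hom_ext_apply fun (z : (pullback a (coinducedPoint a Q).π).obj) => by
    change asHom Q.π (coinducedCounitHom a Q z) = asHom (pullback.fst a (coinducedPoint a Q).π) z
    rw [coinducedCounitHom_apply, map_add, point_section_apply]
    exact (congrArg _ (map_fibre_nil _)).trans (add_zero _)
  σ_comp := hom_ext_apply fun x => by
    change coinducedCounitHom a Q
      (asHom ((PointOver.changeOfBase a).obj (coinducedPoint a Q)).σ x) = asHom Q.σ x
    refine (coinducedCounitHom_apply a Q _).trans ?_
    rw [fst_changeOfBase_section, snd_changeOfBase_section]
    exact add_zero _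

section Lift

variable {a Q} {P : PointOver B} (g : (PointOver.changeOfBase a).obj P ⟶ Q)

variable (P a) in
/-- The projection of the total object to the kernel, as a subspace of the fibre product. -/
def kernelProjection : P.X.obj →ₗ[K] fibreProduct a P.π where
  toFun w := ⟨(0, w - asHom P.σ (asHom P.π w)), by
    change asHom a 0 = asHom P.π (w - asHom P.σ (asHom P.π w))
    rw [map_zero, map_sub, point_section_apply, sub_self]⟩
  map_add' w w' := Subtype.ext <| Prod.ext (add_zero _).symm <| by
    change w + w' - asHom P.σ (asHom P.π (w + w')) = _
    rw [map_add, map_add, add_sub_add_comm]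
    rfl
  map_smul' c w := Subtype.ext <| Prod.ext (smul_zero _).symm <| by
    change c • w - asHom P.σ (asHom P.π (c • w)) = _
    rw [map_smul, map_smul, ← smul_sub]
    rfl

/-- A morphism out of the change of base, as a map on the fibre product. -/
noncomputable def onFibreProduct : fibreProduct a P.π →ₙₐ[K] Q.X.obj :=
  (asHom g.f).comp (asHom (toPullback a P.π))

lemma map_onFibreProduct (w : fibreProduct a P.π) : asHom Q.π (onFibreProduct g w) = w.1.1 :=
  (asHom_congr g.comp_π _).trans (fst_toPullback a P.π w)

lemma onFibreProduct_fst_snd (z : (pullback a P.π).obj) :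
    onFibreProduct g ⟨(asHom (pullback.fst a P.π) z, asHom (pullback.snd a P.π) z),
      pullback_condition_apply a P.π z⟩ = asHom g.f z :=
  congrArg (asHom g.f) (toPullback_fst_snd a P.π z)

/-- The value of the section of the fibre product at `x`. -/
def sectionElement (a : A ⟶ B) (P : PointOver B) (x : A.obj) : fibreProduct a P.π :=
  ⟨(x, asHom P.σ (asHom a x)), (point_section_apply P _).symm⟩

lemma onFibreProduct_section (x : A.obj) :
    onFibreProduct g (sectionElement a P x) = asHom Q.σ x := by
  rw [← asHom_congr g.σ_comp x]
  refine congrArg (asHom g.f) (pullback_ext_apply ?_ ?_)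
  · exact (fst_toPullback a P.π _).trans (fst_changeOfBase_section a P x).symm
  · exact (snd_toPullback a P.π _).trans (snd_changeOfBase_section a P x).symm

/-- The restriction of a morphism out of the change of base to the kernel, extended linearly by
zero on the image of the section. -/
noncomputable def kernelRestriction : P.X.obj →ₗ[K] Q.X.obj :=
  (onFibreProduct g : fibreProduct a P.π →ₗ[K] Q.X.obj).comp (kernelProjection a P)

lemma kernelRestriction_apply {k : P.X.obj} (hk : asHom P.π k = 0) :
    kernelRestriction g k = onFibreProduct g (kernelElement a hk) := by
  refine congrArg (onFibreProduct g) (Subtype.ext (Prod.ext rfl ?_))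
  change k - asHom P.σ (asHom P.π k) = k
  rw [hk, map_zero, sub_zero]

lemma kernelMap_kernelRestriction :
    KernelMap (asHom a) (asHom Q.π) (asHom Q.σ) (asHom P.π) (asHom P.σ) (kernelRestriction g) where
  map_section := point_section_apply P
  map_mul k k' hk hk' := by
    have h : asHom P.π (k * k') = 0 := by rw [map_mul, hk, zero_mul]
    rw [kernelRestriction_apply g hk, kernelRestriction_apply g hk', kernelRestriction_apply g h,
      ← map_mul]
    exact congrArg (onFibreProduct g) (Subtype.ext (Prod.ext (mul_zero (0 : A.obj)).symm rfl))
  map_act x k hk := by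
    have h : asHom P.π (asHom P.σ (asHom a x) * k) = 0 := by rw [map_mul, hk, mul_zero]
    rw [kernelRestriction_apply g hk, kernelRestriction_apply g h, ← onFibreProduct_section g,
      ← map_mul]
    exact congrArg (onFibreProduct g) (Subtype.ext (Prod.ext (mul_zero x).symm rfl))
  map_map k hk := by
    rw [kernelRestriction_apply g hk, map_onFibreProduct]
    rfl

/-- The morphism to the coinduced point that corresponds to `g`. -/
noncomputable def coinducedLift : P ⟶ coinducedPoint a Q where
  f := ofHom ((kernelMap_kernelRestriction g).toSemidirectSum (isLieMul_obj P.X)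
    (isLieMul_obj Q.X))
  comp_π := hom_ext_apply fun _ => rfl
  σ_comp := hom_ext_apply fun b =>
    (kernelMap_kernelRestriction g).toSemidirectSum_section (isLieMul_obj P.X)
      (isLieMul_obj Q.X) b

lemma changeOfBase_map_comp_counit_apply (h : P ⟶ coinducedPoint a Q)
    (z : (pullback a P.π).obj) :
    asHom ((PointOver.changeOfBase a).map h ≫ coinducedCounit a Q).f z =
      asHom Q.σ (asHom (pullback.fst a P.π) z) +
        (SemidirectSum.fibre (asHom h.f (asHom (pullback.snd a P.π) z)) :
          List B.obj → Q.X.obj) [] := by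
  refine (coinducedCounitHom_apply a Q (asHom ((PointOver.changeOfBase a).map h).f z)).trans ?_
  rw [fst_changeOfBase_map, snd_changeOfBase_map]

lemma coinducedLift_fac :
    (PointOver.changeOfBase a).map (coinducedLift g) ≫ coinducedCounit a Q = g := by
  refine PointOver.hom_ext (hom_ext_apply fun (z : (pullback a P.π).obj) => ?_)
  rw [changeOfBase_map_comp_counit_apply, ← onFibreProduct_section g,
    ← onFibreProduct_fst_snd g]
  set w := asHom (pullback.snd a P.π) z with hw
  have hk : asHom P.π (w - asHom P.σ (asHom P.π w)) = 0 :=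
    (kernelMap_kernelRestriction g).map_sub_section w
  change _ + kernelRestriction g (w - asHom P.σ (asHom P.π w)) = _
  -- The pair of projections of `z` is the sum of a section element and a kernel element; `g` is
  -- known on each.
  rw [kernelRestriction_apply g hk, ← map_add]
  refine congrArg (onFibreProduct g) (Subtype.ext (Prod.ext (add_zero _) ?_))
  change asHom P.σ (asHom a _) + (w - asHom P.σ (asHom P.π w)) = w
  rw [pullback_condition_apply, hw, add_sub_cancel]

lemma coinducedLift_uniq (h : P ⟶ coinducedPoint a Q)
    (hg : (PointOver.changeOfBase a).map h ≫ coinducedCounit a Q = g) : h = coinducedLift g := by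
  have key := (kernelMap_kernelRestriction g).eq_toSemidirectSum (isLieMul_obj P.X)
    (isLieMul_obj Q.X) (asHom h.f) (fun w => asHom_congr h.comp_π w)
    (fun b => asHom_congr h.σ_comp b) fun k hk => by
      rw [kernelRestriction_apply g hk, ← hg]
      refine Eq.trans ?_ (changeOfBase_map_comp_counit_apply h
        (asHom (toPullback a P.π) (kernelElement a hk))).symm
      rw [fst_toPullback, snd_toPullback]
      change _ = asHom Q.σ 0 + _
      rw [map_zero]
      exact (zero_add _).symm
  exact PointOver.hom_ext (hom_ext_apply fun w => DFunLike.congr_fun key w)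

end Lift

/-- The category of Lie algebras is locally algebraically cartesian closed. -/
theorem isLACC_lie (K : Type u) [Field K] : IsLACC (lie K).FullSubcategory := by
  refine ⟨hasFiniteLimits_models (lieLaws K), fun A B a => ?_⟩
  -- The adjoint is built pointwise: the counit at `Q` is terminal among arrows from the change of
  -- base to `Q`.
  refine isLeftAdjoint_iff_hasTerminal_costructuredArrow.2 fun Q => ?_
  refine IsTerminal.hasTerminal (X := CostructuredArrow.mk (coinducedCounit a Q)) ?_
  exact IsTerminal.ofUniqueHom
    (fun f => CostructuredArrow.homMk (coinducedLift f.hom) (coinducedLift_fac f.hom))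
    fun f m => CostructuredArrow.hom_ext _ _ (coinducedLift_uniq f.hom m.left
      (CostructuredArrow.w m))

end NonAssocAlgCat

/-! ### Monomials of the free non-associative algebra -/

namespace FreeMagma

lemma eq_of_of_length_eq_one {σ : Type*} {m : FreeMagma σ} (h : m.length = 1) : ∃ i, m = of i := by
  cases m with
  | of j => exact ⟨j, rfl⟩
  | mul m n =>
    have := m.length_pos
    have := n.length_pos
    change m.length + n.length = 1 at h
    omega

lemma eq_of_mul_of_of_length_eq_two {σ : Type*} {m : FreeMagma σ} (h : m.length = 2) :
    ∃ i j, m = of i * of j := by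
  cases m with
  | of j => simp [FreeMagma.length] at h
  | mul m n =>
    have := m.length_pos
    have := n.length_pos
    change m.length + n.length = 2 at h
    obtain ⟨i, rfl⟩ := eq_of_of_length_eq_one (show m.length = 1 by omega)
    obtain ⟨j, rfl⟩ := eq_of_of_length_eq_one (show n.length = 1 by omega)
    exact ⟨i, j, rfl⟩

/-- The degree of a monomial in the variable `i`. -/
def degreeOf {σ : Type*} [DecidableEq σ] (i : σ) : FreeMagma σ → ℕ
  | of j => if j = i then 1 else 0
  | mul m n => degreeOf i m + degreeOf i n

variable {σ : Type*} [DecidableEq σ]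

@[simp] lemma degreeOf_of (i j : σ) : degreeOf i (of j) = if j = i then 1 else 0 := rfl

@[simp] lemma degreeOf_mul (i : σ) (m n : FreeMagma σ) :
    degreeOf i (m * n) = degreeOf i m + degreeOf i n := rfl

lemma sum_degreeOf [Fintype σ] (m : FreeMagma σ) : ∑ i, degreeOf i m = m.length := by
  induction m with
  | ih1 j => simp [FreeMagma.length]
  | ih2 m n hm hn =>
    change ∑ i, degreeOf i (m * n) = m.length + n.length
    simp only [degreeOf_mul, Finset.sum_add_distrib, hm, hn]

end FreeMagma

/-! ### Homogeneous components of non-associative polynomials. -/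

namespace FreeNonUnitalNonAssocAlgebra

variable {K : Type u} [Field K] {σ : Type v}

variable (K) in
/-- A monomial as an element of the free algebra. -/
noncomputable def monomial (m : FreeMagma σ) : FreeNonUnitalNonAssocAlgebra K σ :=
  MonoidAlgebra.single m 1

lemma of_eq_monomial (i : σ) : of K i = monomial K (FreeMagma.of i) := rfl

lemma monomial_mul (m n : FreeMagma σ) :
    monomial K m * monomial K n = monomial K (m * n) := by
  simp [monomial, MonoidAlgebra.single_mul_single]

lemma induction_monomial {motive : FreeNonUnitalNonAssocAlgebra K σ → Prop}
    (p : FreeNonUnitalNonAssocAlgebra K σ) (zero : motive 0)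
    (add : ∀ p q, motive p → motive q → motive (p + q))
    (smul : ∀ (c : K) p, motive p → motive (c • p))
    (monomial : ∀ m, motive (monomial K m)) : motive p := by
  refine MonoidAlgebra.induction_linear p zero add fun m r => ?_
  have : MonoidAlgebra.single m r = r • FreeNonUnitalNonAssocAlgebra.monomial K m := by
    simp [FreeNonUnitalNonAssocAlgebra.monomial]
  rw [this]
  exact smul _ _ (monomial m)

/-- The linear map with given values on monomials. -/
noncomputable def linearExtension {M : Type*} [AddCommGroup M] [Module K M]
    (f : FreeMagma σ → M) : FreeNonUnitalNonAssocAlgebra K σ →ₗ[K] M :=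
  (Finsupp.linearCombination K f).comp (MonoidAlgebra.coeffLinearEquiv K).toLinearMap

@[simp] lemma linearExtension_monomial {M : Type*} [AddCommGroup M] [Module K M]
    (f : FreeMagma σ → M) (m : FreeMagma σ) :
    linearExtension f (monomial K m) = f m := by
  simp [linearExtension, monomial]

variable [DecidableEq σ]

variable (K) in
/-- The homogeneous component of degree `d` in the variable `i`. -/
noncomputable def component (i : σ) (d : ℕ) :
    FreeNonUnitalNonAssocAlgebra K σ →ₗ[K] FreeNonUnitalNonAssocAlgebra K σ :=
  linearExtension fun m => if m.degreeOf i = d then monomial K m else 0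

lemma component_monomial (i : σ) (d : ℕ) (m : FreeMagma σ) :
    component K i d (monomial K m) = if m.degreeOf i = d then monomial K m else 0 :=
  linearExtension_monomial _ _

variable {A : Type*} [NonUnitalNonAssocRing A] [Module K A] [IsScalarTower K A A]
  [SMulCommClass K A A]

lemma lift_scale_monomial (e : σ → A) (i : σ) (t : K) (m : FreeMagma σ) :
    lift K (fun j => if j = i then t • e j else e j) (monomial K m) =
      t ^ m.degreeOf i • lift K e (monomial K m) := by
  induction m with
  | ih1 j =>
    rw [← of_eq_monomial, lift_of_apply, lift_of_apply, FreeMagma.degreeOf_of]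
    split_ifs <;> simp
  | ih2 m n hm hn =>
    rw [← monomial_mul, map_mul, map_mul, hm, hn, FreeMagma.degreeOf_mul, pow_add,
      smul_mul_smul_comm]

/-- The bound depends only on `i` and `p`, not on the algebra or the evaluation. Allowing every `n ≥
N` lets two summands share a range. -/
lemma exists_lift_scale_eq (i : σ) (p : FreeNonUnitalNonAssocAlgebra K σ) :
    ∃ N, ∀ n ≥ N, ∀ {A : Type u} [NonUnitalNonAssocRing A] [Module K A] [IsScalarTower K A A]
      [SMulCommClass K A A] (e : σ → A) (t : K),
      lift K (fun j => if j = i then t • e j else e j) p =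
        ∑ d ∈ Finset.range n, t ^ d • lift K e (component K i d p) := by
  induction p using induction_monomial with
  | zero => exact ⟨0, fun n _ => by simp⟩
  | add p q hp hq =>
    obtain ⟨N, hN⟩ := hp
    obtain ⟨N', hN'⟩ := hq
    refine ⟨max N N', fun n hn A _ _ _ _ e t => ?_⟩
    rw [map_add, hN n (le_of_max_le_left hn), hN' n (le_of_max_le_right hn)]
    simp only [map_add, smul_add, Finset.sum_add_distrib]
  | smul c p hp =>
    obtain ⟨N, hN⟩ := hp
    refine ⟨N, fun n hn A _ _ _ _ e t => ?_⟩
    rw [map_smul, hN n hn, Finset.smul_sum]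
    simp only [map_smul, smul_comm c]
  | monomial m =>
    refine ⟨m.degreeOf i + 1, fun n hn A _ _ _ _ e t => ?_⟩
    rw [lift_scale_monomial]
    simp only [component_monomial]
    rw [Finset.sum_eq_single (m.degreeOf i)]
    · rw [if_pos rfl]
    · intro d _ hd
      rw [if_neg hd.symm, map_zero, smul_zero]
    · intro h
      exact absurd (Finset.mem_range.2 hn) h

end FreeNonUnitalNonAssocAlgebra

/-- Linear forms reduce this to scalars, where a polynomial vanishing on an infinite field has zero
coefficients. -/
lemma eq_zero_of_forall_sum_pow_smul_eq_zero {K M : Type*} [Field K] [Infinite K]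
    [AddCommGroup M] [Module K M] {n : ℕ} {v : ℕ → M}
    (h : ∀ t : K, ∑ d ∈ Finset.range n, t ^ d • v d = 0) {d : ℕ} (hd : d < n) : v d = 0 := by
  rw [← Module.forall_dual_apply_eq_zero_iff K]
  intro f
  have hp : (∑ d ∈ Finset.range n, Polynomial.monomial d (f (v d)) : Polynomial K) = 0 := by
    refine Polynomial.funext fun t => ?_
    have := congrArg f (h t)
    simpa [Polynomial.eval_finsetSum, map_sum, mul_comm] using this
  have := congrArg (fun q => Polynomial.coeff q d) hp
  simpa [Polynomial.finsetSum_coeff, Polynomial.coeff_monomial, hd] using this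

namespace NonAssocAlgCat

open FreeNonUnitalNonAssocAlgebra

variable {K : Type u} [Field K]

/-! ### Laws and relatively free algebras -/

/-- The laws in the variables `σ` of an equational class. -/
def laws (E : Set (NAPoly K)) (σ : Type) : Submodule K (FreeNonUnitalNonAssocAlgebra K σ) where
  carrier := {p | ∀ A : NonAssocAlgCat K, models E A → ∀ e : σ → A, lift K e p = 0}
  add_mem' hp hq A hA e := by rw [map_add, hp A hA, hq A hA, add_zero]
  zero_mem' _ _ _ := map_zero _
  smul_mem' c p hp A hA e := by rw [map_smul, hp A hA, smul_zero]

variable {E : Set (NAPoly K)} {σ : Type}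

/-- Scaling one variable by `t` turns a law into a polynomial in `t` that vanishes identically; its
coefficients are the components. -/
lemma component_mem_laws [Infinite K] [DecidableEq σ] {p : FreeNonUnitalNonAssocAlgebra K σ}
    (hp : p ∈ laws E σ) (i : σ) (d : ℕ) : component K i d p ∈ laws E σ := by
  intro A hA e
  obtain ⟨N, hN⟩ := exists_lift_scale_eq i p
  refine eq_zero_of_forall_sum_pow_smul_eq_zero (K := K) (n := max N (d + 1))
    (v := fun d => lift K e (component K i d p)) (fun t => ?_) (by omega)
  rw [← hN _ (le_max_left _ _) e t]
  exact hp A hA _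

lemma mul_mem_laws_left {p : FreeNonUnitalNonAssocAlgebra K σ} (hp : p ∈ laws E σ)
    (q : FreeNonUnitalNonAssocAlgebra K σ) : p * q ∈ laws E σ := fun A hA e => by
  rw [map_mul, hp A hA, zero_mul]

lemma mul_mem_laws_right {p : FreeNonUnitalNonAssocAlgebra K σ} (hp : p ∈ laws E σ)
    (q : FreeNonUnitalNonAssocAlgebra K σ) : q * p ∈ laws E σ := fun A hA e => by
  rw [map_mul, hp A hA, mul_zero]

variable (E σ) in
/-- The relatively free algebra on `σ`. -/
def RelFree : Type u := FreeNonUnitalNonAssocAlgebra K σ ⧸ laws E σ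

namespace RelFree

noncomputable instance : AddCommGroup (RelFree E σ) :=
  inferInstanceAs (AddCommGroup (FreeNonUnitalNonAssocAlgebra K σ ⧸ laws E σ))

noncomputable instance : Module K (RelFree E σ) :=
  inferInstanceAs (Module K (FreeNonUnitalNonAssocAlgebra K σ ⧸ laws E σ))

/-- The class of a polynomial in the relatively free algebra. -/
noncomputable def mkLinear : FreeNonUnitalNonAssocAlgebra K σ →ₗ[K] RelFree E σ := (laws E σ).mkQ

lemma mkLinear_surjective : Function.Surjective (mkLinear (E := E) (σ := σ)) :=
  (laws E σ).mkQ_surjective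

lemma mkLinear_eq_iff {p q : FreeNonUnitalNonAssocAlgebra K σ} :
    mkLinear (E := E) p = mkLinear q ↔ p - q ∈ laws E σ := Submodule.Quotient.eq _

noncomputable instance : Mul (RelFree E σ) where
  mul := Quotient.map₂ (· * ·) fun p p' hp q q' hq => by
    replace hp := (laws E σ).quotientRel_def.1 hp
    replace hq := (laws E σ).quotientRel_def.1 hq
    refine (laws E σ).quotientRel_def.2 ?_
    have : p * q - p' * q' = (p - p') * q + p' * (q - q') := by
      rw [sub_mul, mul_sub]
      abel
    rw [this]
    exact add_mem (mul_mem_laws_left hp _) (mul_mem_laws_right hq _)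

lemma mkLinear_mul (p q : FreeNonUnitalNonAssocAlgebra K σ) :
    mkLinear (E := E) (p * q) = mkLinear p * mkLinear q := rfl

noncomputable instance : NonUnitalNonAssocRing (RelFree E σ) where
  left_distrib x y z := by
    obtain ⟨x, rfl⟩ := mkLinear_surjective x
    obtain ⟨y, rfl⟩ := mkLinear_surjective y
    obtain ⟨z, rfl⟩ := mkLinear_surjective z
    simp only [← mkLinear_mul, ← map_add, mul_add]
  right_distrib x y z := by
    obtain ⟨x, rfl⟩ := mkLinear_surjective x
    obtain ⟨y, rfl⟩ := mkLinear_surjective y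
    obtain ⟨z, rfl⟩ := mkLinear_surjective z
    simp only [← mkLinear_mul, ← map_add, add_mul]
  zero_mul x := by
    obtain ⟨x, rfl⟩ := mkLinear_surjective x
    rw [← map_zero mkLinear, ← mkLinear_mul, zero_mul]
  mul_zero x := by
    obtain ⟨x, rfl⟩ := mkLinear_surjective x
    rw [← map_zero mkLinear, ← mkLinear_mul, mul_zero]

instance : IsScalarTower K (RelFree E σ) (RelFree E σ) where
  smul_assoc c x y := by
    obtain ⟨x, rfl⟩ := mkLinear_surjective x
    obtain ⟨y, rfl⟩ := mkLinear_surjective y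
    simp only [smul_eq_mul, ← mkLinear_mul, ← map_smul, smul_mul_assoc]

instance : SMulCommClass K (RelFree E σ) (RelFree E σ) where
  smul_comm c x y := by
    obtain ⟨x, rfl⟩ := mkLinear_surjective x
    obtain ⟨y, rfl⟩ := mkLinear_surjective y
    simp only [smul_eq_mul, ← mkLinear_mul, ← map_smul, mul_smul_comm]

variable (E σ) in
/-- The quotient map onto the relatively free algebra. -/
noncomputable def mk : FreeNonUnitalNonAssocAlgebra K σ →ₙₐ[K] RelFree E σ where
  toFun := mkLinear
  map_smul' := map_smul mkLinear
  map_zero' := map_zero mkLinear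
  map_add' := map_add mkLinear
  map_mul' := mkLinear_mul

lemma mk_surjective : Function.Surjective (mk E σ) := mkLinear_surjective

lemma mk_eq_mk_iff {p q : FreeNonUnitalNonAssocAlgebra K σ} :
    mk E σ p = mk E σ q ↔ p - q ∈ laws E σ := mkLinear_eq_iff

lemma mk_eq_zero_iff {p : FreeNonUnitalNonAssocAlgebra K σ} :
    mk E σ p = 0 ↔ p ∈ laws E σ := Submodule.Quotient.mk_eq_zero _

variable (E) in
/-- The generators of the relatively free algebra. -/
noncomputable def gen (i : σ) : RelFree E σ := mk E σ (FreeNonUnitalNonAssocAlgebra.of K i)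

/-- Evaluations lift to polynomials, and substituting polynomials into an identity of `E` gives a
law. -/
lemma models_relFree : models E (⟨RelFree E σ⟩ : NonAssocAlgCat K) := by
  intro p hp e
  choose q hq using fun n => mk_surjective (E := E) (σ := σ) (e n)
  obtain rfl : (fun n => mk E σ (q n)) = e := funext hq
  have h := map_lift (mk E σ) q p
  refine h.symm.trans (mk_eq_zero_iff.2 fun A hA e' => ?_)
  rw [map_lift]
  exact hA p hp _

/-- The universal property of the relatively free algebra. -/
noncomputable def lift {A : NonAssocAlgCat K} (hA : models E A) (e : σ → A) :
    RelFree E σ →ₙₐ[K] A :=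
  let f : RelFree E σ →ₗ[K] A := (laws E σ).liftQ
    (FreeNonUnitalNonAssocAlgebra.lift K e : FreeNonUnitalNonAssocAlgebra K σ →ₗ[K] A)
    fun _ hp => hp A hA e
  { toFun := f
    map_smul' := map_smul f
    map_zero' := map_zero f
    map_add' := map_add f
    map_mul' x y := by
      obtain ⟨x, rfl⟩ := mk_surjective x
      obtain ⟨y, rfl⟩ := mk_surjective y
      rw [← map_mul]
      exact map_mul (FreeNonUnitalNonAssocAlgebra.lift K e) x y }

lemma lift_mk {A : NonAssocAlgCat K} (hA : models E A) (e : σ → A)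
    (p : FreeNonUnitalNonAssocAlgebra K σ) :
    lift hA e (mk E σ p) = FreeNonUnitalNonAssocAlgebra.lift K e p := rfl

lemma lift_gen {A : NonAssocAlgCat K} (hA : models E A) (e : σ → A) (i : σ) :
    lift hA e (gen E i) = e i :=
  (lift_mk hA e _).trans (FreeNonUnitalNonAssocAlgebra.lift_of_apply _ _ _)

lemma hom_ext {A : Type*} [NonUnitalNonAssocRing A] [Module K A] [IsScalarTower K A A]
    [SMulCommClass K A A] {f g : RelFree E σ →ₙₐ[K] A}
    (h : ∀ i, f (gen E i) = g (gen E i)) : f = g := by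
  have : f.comp (mk E σ) = g.comp (mk E σ) := FreeNonUnitalNonAssocAlgebra.hom_ext _ h
  ext1 x
  obtain ⟨x, rfl⟩ := mk_surjective x
  exact DFunLike.congr_fun this x

end RelFree

end NonAssocAlgCat

namespace NonAssocAlgCat

open FreeNonUnitalNonAssocAlgebra

variable {K : Type u} [Field K] {E : Set (NAPoly K)}

/-! ### Free points and the kernel functor -/

variable (E) in
/-- The relatively free algebra as an object of the equational class. -/
noncomputable def freeObj (σ : Type) : (models E).FullSubcategory := ⟨⟨RelFree E σ⟩, RelFree.models_relFree⟩

variable (E) in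
/-- The map of relatively free algebras that kills all generators but the first. -/
noncomputable def killHom (n : ℕ) : RelFree E (Fin (n + 1)) →ₙₐ[K] RelFree E (Fin 1) :=
  RelFree.lift (A := ⟨RelFree E (Fin 1)⟩) RelFree.models_relFree
    fun i => if i = 0 then RelFree.gen E 0 else 0

variable (E) in
/-- The map of relatively free algebras induced by a map of generators. -/
noncomputable def renameHom {σ τ : Type} (f : σ → τ) : RelFree E σ →ₙₐ[K] RelFree E τ :=
  RelFree.lift (A := ⟨RelFree E τ⟩) RelFree.models_relFree fun i => RelFree.gen E (f i)

lemma killHom_gen (n : ℕ) (i : Fin (n + 1)) :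
    killHom E n (RelFree.gen E i) = if i = 0 then RelFree.gen E 0 else 0 :=
  RelFree.lift_gen _ _ _

lemma renameHom_gen {σ τ : Type} (f : σ → τ) (i : σ) :
    renameHom E f (RelFree.gen E i) = RelFree.gen E (f i) :=
  RelFree.lift_gen _ _ _

variable (E) in
/-- The free point on `n` generators over the free algebra on one generator. -/
noncomputable def freePoint (n : ℕ) : PointOver (freeObj E (Fin 1)) where
  X := freeObj E (Fin (n + 1))
  π := ofHom (killHom E n)
  σ := ofHom (renameHom E fun _ => 0)
  section_comp := by
    refine hom_ext_apply fun x => DFunLike.congr_fun (f := (killHom E n).comp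
      (renameHom E fun _ => 0)) (g := NonUnitalAlgHom.id K (RelFree E (Fin 1))) ?_ x
    refine RelFree.hom_ext fun i => ?_
    obtain rfl := Subsingleton.elim i 0
    rw [NonUnitalAlgHom.comp_apply, renameHom_gen, killHom_gen, if_pos rfl]
    rfl

variable (E) in
/-- The morphism of free points that sends the generator to the `j`-th generator. -/
noncomputable def freePointIncl (j : Fin 2) : freePoint E 1 ⟶ freePoint E 2 where
  f := ofHom (renameHom E ![0, j.succ])
  comp_π := by
    refine hom_ext_apply fun x => DFunLike.congr_fun (f := (killHom E 2).comp
      (renameHom E ![0, j.succ])) (g := killHom E 1) ?_ x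
    refine RelFree.hom_ext fun i => ?_
    rw [NonUnitalAlgHom.comp_apply, renameHom_gen, killHom_gen, killHom_gen]
    fin_cases i <;> simp
  σ_comp := by
    refine hom_ext_apply fun x => DFunLike.congr_fun (f := (renameHom E ![0, j.succ]).comp
      (renameHom E fun _ : Fin 1 => 0)) (g := renameHom E fun _ => 0) ?_ x
    refine RelFree.hom_ext fun i => ?_
    rw [NonUnitalAlgHom.comp_apply, renameHom_gen, renameHom_gen, renameHom_gen]
    rfl

lemma freePoint_hom_ext {n : ℕ} {R : PointOver (freeObj E (Fin 1))} {f g : freePoint E n ⟶ R}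
    (h : ∀ i : Fin n, asHom f.f (RelFree.gen E i.succ) = asHom g.f (RelFree.gen E i.succ)) :
    f = g := by
  refine PointOver.hom_ext (hom_ext_apply fun x => DFunLike.congr_fun (f := asHom f.f)
    (g := asHom g.f) ?_ x)
  refine RelFree.hom_ext fun i => ?_
  induction i using Fin.cases with
  | zero =>
    have hf := asHom_congr f.σ_comp (RelFree.gen E (0 : Fin 1))
    have hg := asHom_congr g.σ_comp (RelFree.gen E (0 : Fin 1))
    have h0 : asHom (freePoint E n).σ (RelFree.gen E (0 : Fin 1)) =
      RelFree.gen E (0 : Fin (n + 1)) := renameHom_gen _ _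
    replace hf := (congrArg (asHom f.f) h0).symm.trans hf
    exact hf.trans ((congrArg (asHom g.f) h0).symm.trans hg).symm
  | succ i => exact h i

/-- Every choice of values in the kernel extends to a morphism out of a free point. -/
lemma exists_freePoint_hom {n : ℕ} {R : PointOver (freeObj E (Fin 1))} (v : Fin n → R.X.obj)
    (hv : ∀ i, asHom R.π (v i) = 0) :
    ∃ f : freePoint E n ⟶ R, ∀ i : Fin n, asHom f.f (RelFree.gen E i.succ) = v i := by
  let e : Fin (n + 1) → R.X.obj := Fin.cons (asHom R.σ (RelFree.gen E (0 : Fin 1))) v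
  let f : RelFree E (Fin (n + 1)) →ₙₐ[K] R.X.obj := RelFree.lift R.X.property e
  have hf : ∀ i, f (RelFree.gen E i) = e i := RelFree.lift_gen _ _
  refine ⟨⟨ofHom f, ?_, ?_⟩, fun i => hf _⟩
  · let r : R.X.obj →ₙₐ[K] RelFree E (Fin 1) := asHom R.π
    refine hom_ext_apply fun x => DFunLike.congr_fun (f := r.comp f)
      (g := killHom E n) ?_ x
    refine RelFree.hom_ext fun i => ?_
    rw [killHom_gen, NonUnitalAlgHom.comp_apply, hf]
    induction i using Fin.cases with
    | zero => exact point_section_apply R _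
    | succ i =>
      rw [if_neg (Fin.succ_ne_zero i)]
      exact hv i
  · refine hom_ext_apply fun x => DFunLike.congr_fun (f := f.comp (renameHom E fun _ => 0))
      (g := asHom R.σ) ?_ x
    refine RelFree.hom_ext fun i => ?_
    obtain rfl := Subsingleton.elim i 0
    rw [NonUnitalAlgHom.comp_apply, renameHom_gen, hf]
    rfl

variable (E) in
/-- The zero morphism from the trivial algebra. -/
def fromTrivial (B : (models E).FullSubcategory) : trivialObj E ⟶ B := ofHom 0

/-- An object as a point over the trivial algebra. -/
def trivialPoint (W : (models E).FullSubcategory) : PointOver (trivialObj E) where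
  X := W
  π := ofHom 0
  σ := ofHom 0
  section_comp := hom_ext_apply fun _ => rfl

/-- A morphism into an object as a morphism of points over the trivial algebra. -/
def toTrivialPoint {P : PointOver (trivialObj E)} {W : (models E).FullSubcategory}
    (f : P.X ⟶ W) : P ⟶ trivialPoint W where
  f := f
  comp_π := hom_ext_apply fun _ => rfl
  σ_comp := hom_ext_apply fun x => by
    obtain rfl : x = 0 := rfl
    exact (map_zero (asHom (P.σ ≫ f))).trans (map_zero (asHom (trivialPoint W).σ)).symm

variable (E) in
/-- The kernel of a point over the free algebra on one generator. -/
noncomputable abbrev kernelFunctor : PointOver (freeObj E (Fin 1)) ⥤ PointOver (trivialObj E) :=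
  PointOver.changeOfBase (fromTrivial E (freeObj E (Fin 1)))

/-- Uniqueness half of the statement that the kernel of the free point on two generators is a
coproduct of two copies of the kernel for one generator. Under the adjunction it becomes uniqueness
for maps out of a free point. -/
lemma kernel_hom_ext (hE : (kernelFunctor E).IsLeftAdjoint)
    {W : (models E).FullSubcategory}
    {f g : ((kernelFunctor E).obj (freePoint E 2)).X ⟶ W}
    (h : ∀ j, ((kernelFunctor E).map (freePointIncl E j)).f ≫ f =
      ((kernelFunctor E).map (freePointIncl E j)).f ≫ g) : f = g := by
  let adj := Adjunction.ofIsLeftAdjoint (kernelFunctor E)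
  suffices H : toTrivialPoint f = toTrivialPoint g from congrArg PointOver.Hom.f H
  apply (adj.homEquiv _ _).injective
  have key : ∀ j, freePointIncl E j ≫ adj.homEquiv _ _ (toTrivialPoint f) =
      freePointIncl E j ≫ adj.homEquiv _ _ (toTrivialPoint g) := by
    intro j
    rw [← adj.homEquiv_naturality_left, ← adj.homEquiv_naturality_left]
    exact congrArg _ (PointOver.hom_ext (h j))
  refine freePoint_hom_ext fun i => ?_
  have h1 : asHom (freePointIncl E i).f (RelFree.gen E (1 : Fin 2)) = RelFree.gen E i.succ :=
    renameHom_gen _ _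
  rw [← h1]
  exact asHom_congr (congrArg PointOver.Hom.f (key i)) (RelFree.gen E (1 : Fin 2))

/-- Existence half: the transposes of the two maps send the generator into a kernel, and freeness
glues them before transposing back. -/
lemma exists_kernel_hom (hE : (kernelFunctor E).IsLeftAdjoint)
    {W : (models E).FullSubcategory}
    (f : Fin 2 → (((kernelFunctor E).obj (freePoint E 1)).X ⟶ W)) :
    ∃ g : ((kernelFunctor E).obj (freePoint E 2)).X ⟶ W,
      ∀ j, ((kernelFunctor E).map (freePointIncl E j)).f ≫ g = f j := by
  let adj := Adjunction.ofIsLeftAdjoint (kernelFunctor E)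
  let t (j : Fin 2) := adj.homEquiv _ _ (toTrivialPoint (f j))
  have h1 : asHom (freePoint E 1).π (RelFree.gen E (1 : Fin 2)) = 0 := killHom_gen 1 1
  obtain ⟨r, hr⟩ := exists_freePoint_hom
    (fun j => asHom (t j).f (RelFree.gen E (1 : Fin 2)))
    (fun j => (asHom_congr (t j).comp_π _).trans h1)
  refine ⟨((adj.homEquiv _ _).symm r).f, fun j => ?_⟩
  have key : freePointIncl E j ≫ r = t j := by
    refine freePoint_hom_ext fun i => ?_
    obtain rfl := Subsingleton.elim i 0
    refine Eq.trans ?_ (hr j)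
    exact congrArg (asHom r.f) (renameHom_gen _ _)
  have h2 : (kernelFunctor E).map (freePointIncl E j) ≫ (adj.homEquiv _ _).symm r =
      toTrivialPoint (f j) := by
    rw [← adj.homEquiv_naturality_left_symm, key, Equiv.symm_apply_apply]
  exact congrArg PointOver.Hom.f h2

/-- The kernel of the free point on two generators is generated by the images of the kernels of
the free points on one generator. -/
lemma kernel_induction (hE : (kernelFunctor E).IsLeftAdjoint)
    {motive : RelFree E (Fin 3) → Prop}
    (incl : ∀ (j : Fin 2) (x : RelFree E (Fin 2)), killHom E 1 x = 0 →
      motive (renameHom E ![0, j.succ] x))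
    (add : ∀ x y, motive x → motive y → motive (x + y)) (zero : motive 0)
    (mul : ∀ x y, motive x → motive y → motive (x * y))
    (smul : ∀ (c : K) x, motive x → motive (c • x))
    {x : RelFree E (Fin 3)} (hx : killHom E 2 x = 0) : motive x := by
  let a := fromTrivial E (freeObj E (Fin 1))
  let snd₁ := asHom (pullback.snd a (freePoint E 1).π)
  let snd₂ := asHom (pullback.snd a (freePoint E 2).π)
  let S : NonUnitalSubalgebra K (pullback a (freePoint E 2).π).obj :=
    { carrier := {z | motive (snd₂ z)}
      add_mem' := fun {y z} hy hz => by
        change motive (snd₂ (y + z))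
        rw [map_add]
        exact add _ _ hy hz
      zero_mem' := by
        change motive (snd₂ 0)
        rw [map_zero]
        exact zero
      mul_mem' := fun {y z} hy hz => by
        change motive (snd₂ (y * z))
        rw [map_mul]
        exact mul _ _ hy hz
      smul_mem' := fun c z hz => by
        change motive (snd₂ (c • z))
        rw [map_smul]
        exact smul _ _ hz }
  let SObj : (models E).FullSubcategory := ⟨⟨S⟩, models_subalgebra (pullback a _).property S⟩
  have hS : ∀ j (z : (pullback a (freePoint E 1).π).obj),
      asHom ((kernelFunctor E).map (freePointIncl E j)).f z ∈ S := by
    intro j z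
    change motive (snd₂ (asHom ((kernelFunctor E).map (freePointIncl E j)).f z))
    have h := snd_changeOfBase_map a (freePointIncl E j) z
    rw [h]
    refine incl j (snd₁ z) ?_
    exact (pullback_condition_apply a (freePoint E 1).π z).symm
  let f (j : Fin 2) : ((kernelFunctor E).obj (freePoint E 1)).X ⟶ SObj :=
    ofHom (NonUnitalAlgHom.codRestrict
      (asHom ((kernelFunctor E).map (freePointIncl E j)).f) S (hS j))
  obtain ⟨g, hg⟩ := exists_kernel_hom hE f
  let i : SObj ⟶ ((kernelFunctor E).obj (freePoint E 2)).X :=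
    ofHom (NonUnitalSubalgebraClass.subtype S)
  -- Both maps agree on the two summands of the coproduct. Thus the inclusion of `S` has a right
  -- inverse, so `S` is everything.
  have hgi : g ≫ i = 𝟙 _ := by
    refine kernel_hom_ext hE fun j => ?_
    rw [← Category.assoc, hg, Category.comp_id]
    exact hom_ext_apply fun _ => rfl
  let z := asHom (toPullback a (freePoint E 2).π) (kernelElement a (P := freePoint E 2) hx)
  have hz : snd₂ z = x := snd_toPullback a (freePoint E 2).π _
  have hgz : asHom i (asHom g z) = z := asHom_congr hgi z
  have := (asHom g z : S).2
  have h' : motive (snd₂ z) := by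
    rw [← hgz]
    exact this
  rwa [hz] at h'

end NonAssocAlgCat

namespace NonAssocAlgCat

open FreeNonUnitalNonAssocAlgebra

variable {K : Type u} [Field K] {E : Set (NAPoly K)}

/-! ### Elements of the kernel of a free point -/

variable (K) in
/-- The span of a set of monomials. -/
noncomputable def monomialSpan {σ : Type} (s : Set (FreeMagma σ)) :
    Submodule K (FreeNonUnitalNonAssocAlgebra K σ) :=
  Submodule.span K (monomial K '' s)

lemma monomial_mem_monomialSpan {σ : Type} {s : Set (FreeMagma σ)} {m : FreeMagma σ}
    (hm : m ∈ s) : monomial K m ∈ monomialSpan K s :=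
  Submodule.subset_span ⟨m, hm, rfl⟩

lemma map_mem_of_mem_monomialSpan {σ : Type} {s : Set (FreeMagma σ)} {M : Type*}
    [AddCommGroup M] [Module K M] (f : FreeNonUnitalNonAssocAlgebra K σ →ₗ[K] M)
    {N : Submodule K M} (h : ∀ m ∈ s, f (monomial K m) ∈ N)
    {p : FreeNonUnitalNonAssocAlgebra K σ} (hp : p ∈ monomialSpan K s) : f p ∈ N := by
  have : monomialSpan K s ≤ N.comap f := by
    refine Submodule.span_le.2 ?_
    rintro _ ⟨m, hm, rfl⟩
    exact h m hm
  exact this hp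

lemma mul_mem_of_mem_monomialSpan {σ : Type} {s : Set (FreeMagma σ)}
    {M : Submodule K (FreeNonUnitalNonAssocAlgebra K σ)}
    (h : ∀ m ∈ s, ∀ n ∈ s, monomial K (m * n) ∈ M) {p q : FreeNonUnitalNonAssocAlgebra K σ}
    (hp : p ∈ monomialSpan K s) (hq : q ∈ monomialSpan K s) : p * q ∈ M := by
  induction hp, hq using Submodule.span_induction₂ with
  | mem_mem p q hp hq =>
    obtain ⟨m, hm, rfl⟩ := hp
    obtain ⟨n, hn, rfl⟩ := hq
    rw [monomial_mul]
    exact h m hm n hn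
  | zero_left q _ => rw [zero_mul]; exact zero_mem _
  | zero_right p _ => rw [mul_zero]; exact zero_mem _
  | add_left p p' q _ _ _ h h' => rw [add_mul]; exact add_mem h h'
  | add_right p q q' _ _ _ h h' => rw [mul_add]; exact add_mem h h'
  | smul_left c p q _ _ h => rw [smul_mul_assoc]; exact Submodule.smul_mem _ _ h
  | smul_right c p q _ _ h => rw [mul_smul_comm]; exact Submodule.smul_mem _ _ h

lemma sub_component_mem_monomialSpan {σ : Type} [DecidableEq σ] (i : σ)
    (p : FreeNonUnitalNonAssocAlgebra K σ) :
    p - component K i 0 p ∈ monomialSpan K {m : FreeMagma σ | 1 ≤ m.degreeOf i} := by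
  induction p using induction_monomial with
  | zero => simp
  | add p q hp hq =>
    rw [map_add, add_sub_add_comm]
    exact add_mem hp hq
  | smul c p hp =>
    rw [map_smul, ← smul_sub]
    exact Submodule.smul_mem _ _ hp
  | monomial m =>
    rw [component_monomial]
    split_ifs with h
    · rw [sub_self]
      exact zero_mem _
    · rw [sub_zero]
      exact monomial_mem_monomialSpan (Nat.one_le_iff_ne_zero.2 h)

lemma lift_component_zero {σ : Type} [DecidableEq σ] {A : Type u} [NonUnitalNonAssocRing A]
    [Module K A] [IsScalarTower K A A] [SMulCommClass K A A] (e : σ → A) (i : σ)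
    (p : FreeNonUnitalNonAssocAlgebra K σ) :
    FreeNonUnitalNonAssocAlgebra.lift K e (component K i 0 p) =
      FreeNonUnitalNonAssocAlgebra.lift K (fun j => if j = i then 0 else e j) p := by
  obtain ⟨N, hN⟩ := exists_lift_scale_eq i p
  -- At `t = 0` only degree zero survives, since `0 ^ 0 = 1`; the bound `N + 1` keeps that degree in
  -- the range.
  have h := hN (N + 1) (Nat.le_succ N) e 0
  simp only [zero_smul] at h
  rw [h, Finset.sum_range_succ']
  simp

/-- Elements of the kernel are represented by combinations of monomials in which the second
variable occurs. -/
lemma exists_mk_eq_of_killHom_eq_zero {x : RelFree E (Fin 2)} (hx : killHom E 1 x = 0) :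
    ∃ p ∈ monomialSpan K {m : FreeMagma (Fin 2) | 1 ≤ m.degreeOf 1},
      RelFree.mk E (Fin 2) p = x := by
  obtain ⟨p, rfl⟩ := RelFree.mk_surjective x
  refine ⟨_, sub_component_mem_monomialSpan 1 p, ?_⟩
  rw [RelFree.mk_eq_mk_iff, sub_sub_cancel_left, neg_mem_iff]
  intro A hA e
  rw [lift_component_zero, ← RelFree.lift_mk hA]
  -- Evaluating with the second variable at zero factors through `killHom`, which kills `x`.
  have h : RelFree.lift hA (fun j : Fin 2 => if j = 1 then 0 else e j) =
      (RelFree.lift hA (fun _ : Fin 1 => e 0)).comp (killHom E 1) := by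
    refine RelFree.hom_ext fun i => ?_
    rw [NonUnitalAlgHom.comp_apply, killHom_gen, RelFree.lift_gen]
    match i with
    | 0 => rw [if_neg zero_ne_one, if_pos rfl, RelFree.lift_gen]
    | 1 => rw [if_pos rfl, if_neg one_ne_zero, map_zero]
  rw [h, NonUnitalAlgHom.comp_apply, hx, map_zero]

/-! ### The law expressing `b(xy)` by `(bx)y` and `x(by)` -/

variable (K) in
/-- The polynomials that evaluate to combinations of `(bx)y` and `x(by)` in alternating
algebras. -/
def derivationSpan : Submodule K (FreeNonUnitalNonAssocAlgebra K (Fin 3)) where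
  carrier := {p | ∃ c d : K, ∀ A : NonAssocAlgCat K, alternating K A → ∀ e : Fin 3 → A,
    FreeNonUnitalNonAssocAlgebra.lift K e p = c • (e 0 * e 1 * e 2) + d • (e 1 * (e 0 * e 2))}
  add_mem' := by
    rintro p q ⟨c, d, h⟩ ⟨c', d', h'⟩
    refine ⟨c + c', d + d', fun A hA e => ?_⟩
    rw [map_add, h A hA, h' A hA]
    module
  zero_mem' := ⟨0, 0, fun A hA e => by simp⟩
  smul_mem' := by
    rintro r p ⟨c, d, h⟩
    refine ⟨r * c, r * d, fun A hA e => ?_⟩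
    rw [map_smul, h A hA]
    module

/-- In degree three one factor is a single variable. Since each factor involves x or y, that
variable is not b, which rules out ±b(xy). Anticommutativity reduces the other arrangements to (bx)y
or x(by). -/
lemma monomial_mem_derivationSpan {m n : FreeMagma (Fin 3)}
    (hm : 1 ≤ m.degreeOf 1 + m.degreeOf 2) (hn : 1 ≤ n.degreeOf 1 + n.degreeOf 2)
    (h₀ : (m * n).degreeOf 0 = 1) (h₁ : (m * n).degreeOf 1 = 1) (h₂ : (m * n).degreeOf 2 = 1) :
    monomial K (m * n) ∈ derivationSpan K := by
  have base : ∀ (i j k : Fin 3), 1 ≤ (FreeMagma.of i).degreeOf 1 + (FreeMagma.of i).degreeOf 2 →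
      (FreeMagma.of i * (FreeMagma.of j * FreeMagma.of k)).degreeOf 0 = 1 →
      (FreeMagma.of i * (FreeMagma.of j * FreeMagma.of k)).degreeOf 1 = 1 →
      (FreeMagma.of i * (FreeMagma.of j * FreeMagma.of k)).degreeOf 2 = 1 →
      ∃ c d : K, ∀ A : NonAssocAlgCat K, alternating K A → ∀ e : Fin 3 → A,
        e i * (e j * e k) = c • (e 0 * e 1 * e 2) + d • (e 1 * (e 0 * e 2)) := by
    intro i j k hi h₀ h₁ h₂
    -- Four cases survive, in order: x(by), x(yb), y(bx), y(xb).
    fin_cases i <;> fin_cases j <;> fin_cases k <;> simp at hi h₀ h₁ h₂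
    · refine ⟨0, 1, fun A hA e => ?_⟩
      simp
    · refine ⟨0, -1, fun A hA e => ?_⟩
      have hA := mul_eq_neg_of_mul_self ((alternating_iff A).1 hA)
      simp [hA (e 2) (e 0)]
    · refine ⟨-1, 0, fun A hA e => ?_⟩
      have hA := mul_eq_neg_of_mul_self ((alternating_iff A).1 hA)
      simp [hA (e 2) (e 0 * e 1)]
    · refine ⟨1, 0, fun A hA e => ?_⟩
      have hA := mul_eq_neg_of_mul_self ((alternating_iff A).1 hA)
      simp [hA (e 2), hA (e 1) (e 0)]
  have hlm := FreeMagma.sum_degreeOf m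
  have hln := FreeMagma.sum_degreeOf n
  rw [Fin.sum_univ_three] at hlm hln
  simp only [FreeMagma.degreeOf_mul] at h₀ h₁ h₂
  have hm' := m.length_pos
  have hn' := n.length_pos
  obtain ⟨hm1, hn2⟩ | ⟨hm2, hn1⟩ :
      (m.length = 1 ∧ n.length = 2) ∨ (m.length = 2 ∧ n.length = 1) := by omega
  · obtain ⟨i, rfl⟩ := FreeMagma.eq_of_of_length_eq_one hm1
    obtain ⟨j, k, rfl⟩ := FreeMagma.eq_of_mul_of_of_length_eq_two hn2
    obtain ⟨c, d, h⟩ := base i j k hm h₀ h₁ h₂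
    refine ⟨c, d, fun A hA e => ?_⟩
    rw [← h A hA]
    simp only [← monomial_mul, ← of_eq_monomial, map_mul, lift_of_apply]
  · obtain ⟨i, rfl⟩ := FreeMagma.eq_of_of_length_eq_one hn1
    obtain ⟨j, k, rfl⟩ := FreeMagma.eq_of_mul_of_of_length_eq_two hm2
    obtain ⟨c, d, h⟩ := base i j k hn ((add_comm _ _).trans h₀) ((add_comm _ _).trans h₁)
      ((add_comm _ _).trans h₂)
    refine ⟨-c, -d, fun A hA e => ?_⟩
    rw [neg_smul, neg_smul, ← neg_add, ← h A hA,
      ← mul_eq_neg_of_mul_self ((alternating_iff A).1 hA)]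
    simp only [← monomial_mul, ← of_eq_monomial, map_mul, lift_of_apply]

variable (K) in
/-- The monomials involving the second or the third variable whose multilinear component
evaluates to a combination of `(bx)y` and `x(by)`. -/
def derivationMonomials : Set (FreeMagma (Fin 3)) :=
  {m | 1 ≤ m.degreeOf 1 + m.degreeOf 2 ∧ (m.degreeOf 0 = 1 → m.degreeOf 1 = 1 →
    m.degreeOf 2 = 1 → monomial K m ∈ derivationSpan K)}

lemma mul_mem_derivationMonomials {m n : FreeMagma (Fin 3)} (hm : m ∈ derivationMonomials K)
    (hn : n ∈ derivationMonomials K) : m * n ∈ derivationMonomials K := by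
  refine ⟨?_, fun h₀ h₁ h₂ => monomial_mem_derivationSpan hm.1 hn.1 h₀ h₁ h₂⟩
  have := hm.1
  simp only [FreeMagma.degreeOf_mul]
  omega

lemma degreeOf_map_fin (j : Fin 2) (m : FreeMagma (Fin 2)) (k : Fin 2) :
    (FreeMagma.map ![(0 : Fin 3), j.succ] m).degreeOf k.succ =
      if j = k then m.degreeOf 1 else 0 := by
  induction m with
  | ih1 i => fin_cases i <;> fin_cases j <;> fin_cases k <;> simp
  | ih2 m n hm hn =>
    rw [map_mul, FreeMagma.degreeOf_mul, hm, hn]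
    split_ifs <;> simp

/-- A monomial from one copy never contains both x and y, so the multilinear condition is vacuous.
-/
lemma map_mem_derivationMonomials (j : Fin 2) {m : FreeMagma (Fin 2)} (hm : 1 ≤ m.degreeOf 1) :
    FreeMagma.map ![(0 : Fin 3), j.succ] m ∈ derivationMonomials K := by
  have h₁ := degreeOf_map_fin j m 0
  have h₂ := degreeOf_map_fin j m 1
  simp only [Fin.succ_zero_eq_one, Fin.succ_one_eq_two] at h₁ h₂
  refine ⟨?_, fun _ h₁' h₂' => ?_⟩
  · rw [h₁, h₂]
    fin_cases j <;> simpa using hm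
  · rw [h₁'] at h₁
    rw [h₂'] at h₂
    fin_cases j
    · simp at h₂
    · simp at h₁

lemma lift_of_monomial {σ τ : Type} (f : σ → τ) (m : FreeMagma σ) :
    FreeNonUnitalNonAssocAlgebra.lift K (fun i => of K (f i)) (monomial K m) =
      monomial K (FreeMagma.map f m) := by
  induction m with
  | ih1 i => rw [← of_eq_monomial, lift_of_apply, FreeMagma.map_of, of_eq_monomial]
  | ih2 m n hm hn => rw [← monomial_mul, map_mul, hm, hn, map_mul, monomial_mul]

lemma renameHom_mk {σ τ : Type} (f : σ → τ) (p : FreeNonUnitalNonAssocAlgebra K σ) :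
    renameHom E f (RelFree.mk E σ p) =
      RelFree.mk E τ (FreeNonUnitalNonAssocAlgebra.lift K (fun i => of K (f i)) p) := by
  rw [map_lift]
  rfl

/-- If the kernel functor is a left adjoint, then `b(xy)` is a fixed linear combination of
`(bx)y` and `x(by)`. -/
lemma exists_mul_mul_eq [Infinite K] (hE : (kernelFunctor E).IsLeftAdjoint)
    (halt : models E ≤ alternating K) :
    ∃ c d : K, ∀ A : NonAssocAlgCat K, models E A → ∀ b x y : A,
      b * (x * y) = c • (b * x * y) + d • (x * (b * y)) := by
  have key : ∀ x : RelFree E (Fin 3), killHom E 2 x = 0 →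
      ∃ p ∈ monomialSpan K (derivationMonomials K), RelFree.mk E (Fin 3) p = x := by
    intro x hx
    refine kernel_induction hE (motive := fun x =>
      ∃ p ∈ monomialSpan K (derivationMonomials K), RelFree.mk E (Fin 3) p = x) ?_ ?_ ?_ ?_ ?_ hx
    · intro j x hx
      obtain ⟨p, hp, rfl⟩ := exists_mk_eq_of_killHom_eq_zero hx
      refine ⟨_, ?_, (renameHom_mk _ _).symm⟩
      refine map_mem_of_mem_monomialSpan
        (FreeNonUnitalNonAssocAlgebra.lift K (fun i => of K (![(0 : Fin 3), j.succ] i)) :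
          FreeNonUnitalNonAssocAlgebra K (Fin 2) →ₗ[K] FreeNonUnitalNonAssocAlgebra K (Fin 3))
        (fun m hm => ?_) hp
      refine Eq.subst (motive := fun q => q ∈ monomialSpan K _) (lift_of_monomial _ m).symm ?_
      exact monomial_mem_monomialSpan (map_mem_derivationMonomials j hm)
    · rintro _ _ ⟨p, hp, rfl⟩ ⟨q, hq, rfl⟩
      exact ⟨p + q, add_mem hp hq, map_add _ _ _⟩
    · exact ⟨0, zero_mem _, map_zero _⟩
    · rintro _ _ ⟨p, hp, rfl⟩ ⟨q, hq, rfl⟩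
      exact ⟨p * q, mul_mem_of_mem_monomialSpan (fun m hm n hn =>
        monomial_mem_monomialSpan (mul_mem_derivationMonomials hm hn)) hp hq, map_mul _ _ _⟩
    · rintro c _ ⟨p, hp, rfl⟩
      exact ⟨c • p, Submodule.smul_mem _ _ hp, map_smul _ _ _⟩
  -- The projection to the component linear in each of b, x and y. It maps laws to laws, so it can
  -- be applied to both representatives of b(xy).
  let C : FreeNonUnitalNonAssocAlgebra K (Fin 3) →ₗ[K] FreeNonUnitalNonAssocAlgebra K (Fin 3) :=
    component K 0 1 ∘ₗ component K 1 1 ∘ₗ component K 2 1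
  have hC : ∀ m : FreeMagma (Fin 3), C (monomial K m) =
      if m.degreeOf 0 = 1 ∧ m.degreeOf 1 = 1 ∧ m.degreeOf 2 = 1 then monomial K m else 0 := by
    intro m
    simp only [C, LinearMap.comp_apply]
    by_cases h₀ : m.degreeOf 0 = 1 <;> by_cases h₁ : m.degreeOf 1 = 1 <;>
      by_cases h₂ : m.degreeOf 2 = 1 <;> simp [component_monomial, h₀, h₁, h₂]
  have hCspan : ∀ p ∈ monomialSpan K (derivationMonomials K), C p ∈ derivationSpan K := by
    refine fun p => map_mem_of_mem_monomialSpan C fun m hm => ?_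
    rw [hC]
    split_ifs with h
    · exact hm.2 h.1 h.2.1 h.2.2
    · exact zero_mem _
  let m₀ : FreeMagma (Fin 3) := FreeMagma.of 0 * (FreeMagma.of 1 * FreeMagma.of 2)
  have hm₀ : monomial K m₀ = of K 0 * (of K 1 * of K 2) := by
    simp only [m₀, ← monomial_mul, of_eq_monomial]
  obtain ⟨p, hp, hpm⟩ := key (RelFree.mk E _ (monomial K m₀)) <| by
    rw [hm₀, map_mul, map_mul, map_mul, map_mul]
    have : killHom E 2 (RelFree.mk E (Fin 3) (of K 1)) = 0 := killHom_gen 2 1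
    rw [this, zero_mul, mul_zero]
  obtain ⟨c, d, hcd⟩ := hCspan p hp
  refine ⟨c, d, fun A hA b x y => ?_⟩
  rw [RelFree.mk_eq_mk_iff] at hpm
  have hlaw : C (p - monomial K m₀) ∈ laws E (Fin 3) :=
    component_mem_laws (component_mem_laws (component_mem_laws hpm 2 1) 1 1) 0 1
  have h := hlaw A hA ![b, x, y]
  rw [map_sub, map_sub, hcd A (halt A hA), hC, if_pos (by simp [m₀]), hm₀, sub_eq_zero] at h
  simpa using h.symm

/-! ### Independence of the two products -/

/-- If the kernel functor is a left adjoint, then linear forms on the kernel of the free point on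
one generator which vanish on products turn a relation between products `xy`, with `x` in the first
and `y` in the second copy of that kernel, into a relation in every algebra of the class. -/
lemma linearForms_smul_eq_zero (hE : (kernelFunctor E).IsLeftAdjoint)
    (halt : models E ≤ alternating K) {W : NonAssocAlgCat K} (hW : models E W) (s : Fin 2 → W)
    (φ : Fin 2 → RelFree E (Fin 2) →ₗ[K] K)
    (hφ : ∀ j x y, killHom E 1 x = 0 → killHom E 1 y = 0 → φ j (x * y) = 0)
    {c d : K} {x y x' y' : RelFree E (Fin 2)} (hx : killHom E 1 x = 0) (hy : killHom E 1 y = 0)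
    (hx' : killHom E 1 x' = 0) (hy' : killHom E 1 y' = 0)
    (h : c • (renameHom E ![(0 : Fin 3), 1] x * renameHom E ![0, 2] y) +
      d • (renameHom E ![0, 1] x' * renameHom E ![0, 2] y') = 0) :
    (c * (φ 0 x * φ 1 y) + d * (φ 0 x' * φ 1 y')) • (s 0 * s 1) = 0 := by
  let a := fromTrivial E (freeObj E (Fin 1))
  let snd₁ : _ →ₙₐ[K] RelFree E (Fin 2) := asHom (pullback.snd a (freePoint E 1).π)
  let snd₂ : _ →ₙₐ[K] RelFree E (Fin 3) := asHom (pullback.snd a (freePoint E 2).π)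
  have hker : ∀ z, killHom E 1 (snd₁ z) = 0 := fun z =>
    (pullback_condition_apply a (freePoint E 1).π z).symm
  -- Multiplicative because both sides vanish: `φ j` kills products and `s j * s j = 0`. The
  -- coproduct property then glues `f 0` and `f 1`.
  let f (j : Fin 2) : (pullback a (freePoint E 1).π).obj →ₙₐ[K] W :=
    { toFun z := φ j (snd₁ z) • s j
      map_smul' r z := by
        rw [map_smul, map_smul, smul_assoc]
        rfl
      map_zero' := by rw [map_zero, map_zero, zero_smul]
      map_add' z z' := by rw [map_add, map_add, add_smul]
      map_mul' z z' := by
        rw [map_mul, hφ j _ _ (hker z) (hker z'), zero_smul, smul_mul_smul_comm,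
          (alternating_iff W).1 (halt W hW), smul_zero] }
  obtain ⟨g, hg⟩ := exists_kernel_hom hE (W := ⟨W, hW⟩) fun j => ofHom (f j)
  let k (v : RelFree E (Fin 2)) (hv : killHom E 1 v = 0) : (pullback a (freePoint E 1).π).obj :=
    asHom (toPullback a (freePoint E 1).π) (kernelElement a (P := freePoint E 1) hv)
  have hk : ∀ v hv, snd₁ (k v hv) = v := fun v hv => snd_toPullback a (freePoint E 1).π _
  let r (j : Fin 2) : (pullback a (freePoint E 1).π).obj →ₙₐ[K] (pullback a (freePoint E 2).π).obj :=
    asHom ((kernelFunctor E).map (freePointIncl E j)).f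
  have hr : ∀ j z, snd₂ (r j z) = renameHom E ![0, j.succ] (snd₁ z) := fun j z =>
    snd_changeOfBase_map a (freePointIncl E j) z
  let G : (pullback a (freePoint E 2).π).obj →ₙₐ[K] W := asHom g
  have hG : ∀ j z, G (r j z) = φ j (snd₁ z) • s j := fun j z => asHom_congr (hg j) z
  have hz : c • (r 0 (k x hx) * r 1 (k y hy)) + d • (r 0 (k x' hx') * r 1 (k y' hy')) = 0 := by
    refine pullback_ext_apply rfl ?_
    change snd₂ _ = snd₂ 0
    simp only [map_add, map_smul, map_mul, hr, hk, map_zero]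
    exact h
  have := congrArg G hz
  simp only [map_add, map_smul, map_mul, hG, hk, map_zero, smul_mul_smul_comm] at this
  rw [← this]
  module

/-- The linear form on the relatively free algebra induced by a linear form that vanishes on the
laws. -/
noncomputable def RelFree.linearForm {σ : Type} (f : FreeNonUnitalNonAssocAlgebra K σ →ₗ[K] K)
    (hf : ∀ p ∈ laws E σ, f p = 0) : RelFree E σ →ₗ[K] K :=
  (laws E σ).liftQ f hf

lemma RelFree.linearForm_mk {σ : Type} (f : FreeNonUnitalNonAssocAlgebra K σ →ₗ[K] K)
    (hf : ∀ p ∈ laws E σ, f p = 0) (p : FreeNonUnitalNonAssocAlgebra K σ) :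
    RelFree.linearForm f hf (RelFree.mk E σ p) = f p := rfl

/-- Kernel elements have degree at least one in x, so their products have degree at least two, where
`f` vanishes. -/
lemma linearForm_mul_eq_zero {f : FreeMagma (Fin 2) → K}
    (hf : ∀ p ∈ laws E (Fin 2), linearExtension f p = 0)
    (hf' : ∀ m : FreeMagma (Fin 2), 2 ≤ m.degreeOf 1 → f m = 0) {x y : RelFree E (Fin 2)}
    (hx : killHom E 1 x = 0) (hy : killHom E 1 y = 0) :
    RelFree.linearForm (linearExtension f) hf (x * y) = 0 := by
  obtain ⟨p, hp, rfl⟩ := exists_mk_eq_of_killHom_eq_zero hx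
  obtain ⟨q, hq, rfl⟩ := exists_mk_eq_of_killHom_eq_zero hy
  rw [← map_mul, RelFree.linearForm_mk]
  refine mul_mem_of_mem_monomialSpan (M := LinearMap.ker (linearExtension f))
    (fun m hm n hn => ?_) hp hq
  rw [LinearMap.mem_ker, linearExtension_monomial]
  refine hf' _ ?_
  rw [FreeMagma.degreeOf_mul]
  exact Nat.add_le_add hm hn

variable (K) in
/-- The coefficient of `x`. -/
def linearCoeff (m : FreeMagma (Fin 2)) : K := if m = FreeMagma.of 1 then 1 else 0

variable (K) in
/-- The coefficient of `bx` minus the coefficient of `xb`. -/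
def bilinearCoeff (m : FreeMagma (Fin 2)) : K :=
  if m = FreeMagma.of 0 * FreeMagma.of 1 then 1 else
    if m = FreeMagma.of 1 * FreeMagma.of 0 then -1 else 0

lemma linearCoeff_eq_zero {m : FreeMagma (Fin 2)} (hm : m.degreeOf 1 ≠ 1) :
    linearCoeff K m = 0 := by
  rw [linearCoeff, if_neg]
  rintro rfl
  simp at hm

lemma bilinearCoeff_eq_zero {m : FreeMagma (Fin 2)} (hm : m.degreeOf 1 ≠ 1) :
    bilinearCoeff K m = 0 := by
  rw [bilinearCoeff, if_neg, if_neg]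
  · rintro rfl
    simp at hm
  · rintro rfl
    simp at hm

lemma lift_component_eq_linearCoeff {A : Type u} [NonUnitalNonAssocRing A] [Module K A]
    [IsScalarTower K A A] [SMulCommClass K A A] (e : Fin 2 → A)
    (p : FreeNonUnitalNonAssocAlgebra K (Fin 2)) :
    FreeNonUnitalNonAssocAlgebra.lift K e (component K 0 0 (component K 1 1 p)) =
      linearExtension (linearCoeff K) p • e 1 := by
  induction p using induction_monomial with
  | zero => simp
  | add p q hp hq => simp only [map_add, hp, hq, add_smul]
  | smul c p hp => simp only [map_smul, hp, smul_eq_mul, mul_smul]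
  | monomial m =>
    rw [component_monomial, linearExtension_monomial]
    by_cases h₁ : m.degreeOf 1 = 1
    · rw [if_pos h₁, component_monomial]
      by_cases h₀ : m.degreeOf 0 = 0
      · have hm := FreeMagma.sum_degreeOf m
        rw [Fin.sum_univ_two, h₀, h₁] at hm
        obtain ⟨i, rfl⟩ := FreeMagma.eq_of_of_length_eq_one hm.symm
        fin_cases i
        · simp at h₀
        · rw [if_pos h₀]
          simp [linearCoeff, ← of_eq_monomial]
      · rw [if_neg h₀, map_zero, linearCoeff, if_neg, zero_smul]
        rintro rfl
        simp at h₀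
    · rw [if_neg h₁, map_zero, map_zero, linearCoeff_eq_zero h₁, zero_smul]

/-- The only monomials of this multidegree are bx and xb, and xb = -bx. A nonzero product in some
algebra of the class therefore forces the coefficient form to vanish on laws, so that it descends to
the relatively free algebra. -/
lemma lift_component_eq_bilinearCoeff {A : Type u} [NonUnitalNonAssocRing A] [Module K A]
    [IsScalarTower K A A] [SMulCommClass K A A] (hA : ∀ x : A, x * x = 0) (e : Fin 2 → A)
    (p : FreeNonUnitalNonAssocAlgebra K (Fin 2)) :
    FreeNonUnitalNonAssocAlgebra.lift K e (component K 0 1 (component K 1 1 p)) =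
      linearExtension (bilinearCoeff K) p • (e 0 * e 1) := by
  induction p using induction_monomial with
  | zero => simp
  | add p q hp hq => simp only [map_add, hp, hq, add_smul]
  | smul c p hp => simp only [map_smul, hp, smul_eq_mul, mul_smul]
  | monomial m =>
    rw [component_monomial, linearExtension_monomial]
    by_cases h₁ : m.degreeOf 1 = 1
    · rw [if_pos h₁, component_monomial]
      by_cases h₀ : m.degreeOf 0 = 1
      · have hm := FreeMagma.sum_degreeOf m
        rw [Fin.sum_univ_two, h₀, h₁] at hm
        obtain ⟨i, j, rfl⟩ := FreeMagma.eq_of_mul_of_of_length_eq_two hm.symm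
        rw [if_pos h₀, ← monomial_mul, map_mul, ← of_eq_monomial, ← of_eq_monomial, lift_of_apply,
          lift_of_apply]
        match i, j with
        | 0, 0 => simp at h₀
        | 0, 1 => rw [bilinearCoeff, if_pos rfl, one_smul]
        | 1, 0 =>
          rw [bilinearCoeff, if_neg (by decide), if_pos rfl, neg_one_smul,
            ← mul_eq_neg_of_mul_self hA]
        | 1, 1 => simp at h₁
      · rw [if_neg h₀, map_zero, bilinearCoeff, if_neg, if_neg, zero_smul]
        · rintro rfl
          simp at h₀
        · rintro rfl
          simp at h₀
    · rw [if_neg h₁, map_zero, map_zero, bilinearCoeff_eq_zero h₁, zero_smul]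

/-- If the kernel functor is a left adjoint and the class is not abelian, then `(bx)y` and `x(by)`
are linearly independent. -/
lemma eq_zero_of_law [Infinite K] (hE : (kernelFunctor E).IsLeftAdjoint)
    (halt : models E ≤ alternating K) {W : NonAssocAlgCat K} (hW : models E W) {s t : W}
    (hst : s * t ≠ 0) {c d : K}
    (h : ∀ A : NonAssocAlgCat K, models E A → ∀ b x y : A,
      c • (b * x * y) + d • (x * (b * y)) = 0) : c = 0 ∧ d = 0 := by
  have hu : ∀ p ∈ laws E (Fin 2), linearExtension (linearCoeff K) p = 0 := fun p hp => by
    have := component_mem_laws (component_mem_laws hp 1 1) 0 0 W hW ![s, t]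
    rw [lift_component_eq_linearCoeff] at this
    refine (smul_eq_zero.1 this).resolve_right ?_
    rintro (rfl : t = 0)
    exact hst (mul_zero _)
  have hv : ∀ p ∈ laws E (Fin 2), linearExtension (bilinearCoeff K) p = 0 := fun p hp => by
    have := component_mem_laws (component_mem_laws hp 1 1) 0 1 W hW ![s, t]
    rw [lift_component_eq_bilinearCoeff ((alternating_iff W).1 (halt W hW))] at this
    exact (smul_eq_zero.1 this).resolve_right hst
  let u := RelFree.linearForm _ hu
  let v := RelFree.linearForm _ hv
  have hu' : ∀ x y, killHom E 1 x = 0 → killHom E 1 y = 0 → u (x * y) = 0 := fun x y hx hy =>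
    linearForm_mul_eq_zero hu (fun m hm => linearCoeff_eq_zero (by omega)) hx hy
  have hv' : ∀ x y, killHom E 1 x = 0 → killHom E 1 y = 0 → v (x * y) = 0 := fun x y hx hy =>
    linearForm_mul_eq_zero hv (fun m hm => bilinearCoeff_eq_zero (by omega)) hx hy
  let b : RelFree E (Fin 2) := RelFree.gen E 0
  let x : RelFree E (Fin 2) := RelFree.gen E 1
  have hbx : b * x = RelFree.mk E (Fin 2) (monomial K (FreeMagma.of 0 * FreeMagma.of 1)) := by
    rw [← monomial_mul, map_mul]
    rfl
  have hux : u x = 1 := by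
    change linearExtension (linearCoeff K) (monomial K (FreeMagma.of 1)) = 1
    rw [linearExtension_monomial, linearCoeff, if_pos rfl]
  have hvx : v x = 0 := by
    change linearExtension (bilinearCoeff K) (monomial K (FreeMagma.of 1)) = 0
    rw [linearExtension_monomial, bilinearCoeff, if_neg (by decide), if_neg (by decide)]
  have hubx : u (b * x) = 0 := by
    rw [hbx, RelFree.linearForm_mk, linearExtension_monomial, linearCoeff, if_neg (by decide)]
  have hvbx : v (b * x) = 1 := by
    rw [hbx, RelFree.linearForm_mk, linearExtension_monomial, bilinearCoeff, if_pos rfl]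
  have hx : killHom E 1 x = 0 := killHom_gen 1 1
  have hbx0 : killHom E 1 (b * x) = 0 := by rw [map_mul, hx, mul_zero]
  have hlaw : c • (renameHom E ![(0 : Fin 3), 1] (b * x) * renameHom E ![0, 2] x) +
      d • (renameHom E ![0, 1] x * renameHom E ![0, 2] (b * x)) = 0 := by
    simp only [map_mul, b, x, renameHom_gen]
    exact h ⟨RelFree E (Fin 3)⟩ RelFree.models_relFree _ _ _
  constructor
  -- The pair (v, u) takes the value 1 on (bx, x) and 0 on (x, bx), which isolates `c`; exchanging
  -- the forms isolates `d`.
  · have := linearForms_smul_eq_zero hE halt hW ![s, t] ![v, u]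
      (Fin.forall_fin_two.2 ⟨hv', hu'⟩) hbx0 hx hx hbx0 hlaw
    simp only [Matrix.cons_val_zero, Matrix.cons_val_one, hux, hvx, hubx, hvbx] at this
    simpa [hst] using this
  · have := linearForms_smul_eq_zero hE halt hW ![s, t] ![u, v]
      (Fin.forall_fin_two.2 ⟨hu', hv'⟩) hbx0 hx hx hbx0 hlaw
    simp only [Matrix.cons_val_zero, Matrix.cons_val_one, hux, hvx, hubx, hvbx] at this
    simpa [hst] using this

/-! ### The Jacobi identity -/

/-- An equational class of alternating algebras for which the kernel functor is a left adjoint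
consists of Lie algebras. -/
lemma models_le_lie [Infinite K] (hE : (kernelFunctor E).IsLeftAdjoint)
    (halt : models E ≤ alternating K) : models E ≤ lie K := by
  intro A hA
  have hsq := (alternating_iff A).1 (halt A hA)
  refine (lie_iff A).2 ⟨hsq, ?_⟩
  by_cases habel : ∀ W : NonAssocAlgCat K, models E W → ∀ s t : W, s * t = 0
  · intro x y z
    simp only [habel A hA, add_zero]
  push Not at habel
  obtain ⟨W, hW, s, t, hst⟩ := habel
  obtain ⟨c, d, hcd⟩ := exists_mul_mul_eq hE halt
  have hanti : ∀ A : NonAssocAlgCat K, models E A → ∀ x y : A, x * y = -(y * x) :=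
    fun A hA => mul_eq_neg_of_mul_self ((alternating_iff A).1 (halt A hA))
  -- Compare the expansions of b(yx) and -b(xy).
  have h₁ := eq_zero_of_law hE halt hW hst (c := c - d) (d := d - c) fun A hA b x y => by
    have h := hcd A hA b y x
    rw [hanti A hA y x, mul_neg, hcd A hA b x y, hanti A hA (b * y) x, hanti A hA y (b * x)] at h
    refine Eq.trans ?_ (sub_eq_zero.2 h.symm)
    module
  obtain rfl : c = d := sub_eq_zero.1 h₁.1
  -- Expand x(by), then the resulting b(xy): x(by) = -c (bx)y + c² (bx)y + c² x(by).
  have h₂ := eq_zero_of_law hE halt hW hst (c := c ^ 2 - c) (d := c ^ 2 - 1) fun A hA b x y => by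
    have h := hcd A hA x b y
    rw [hcd A hA b x y, hanti A hA x b, neg_mul] at h
    refine Eq.trans ?_ (sub_eq_zero.2 h.symm)
    module
  obtain rfl : c = 1 := by linear_combination h₂.2 - h₂.1
  intro x y z
  have h := hcd A hA x y z
  rw [one_smul, one_smul] at h
  rw [h, hanti A hA z (x * y), hanti A hA z x, mul_neg]
  abel

lemma le_lie_of_isLACC [Infinite K] {V : ObjectProperty (NonAssocAlgCat K)}
    (hV : IsAlternatingVariety V) (h : IsLACC V.FullSubcategory) : V ≤ lie K := by
  obtain ⟨⟨E, rfl⟩, halt⟩ := hV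
  obtain ⟨_, hadj⟩ := h
  -- Only the map from the trivial algebra to the free algebra on one generator is needed.
  exact models_le_lie (hadj _ _ _) halt

lemma isAlternatingVariety_lie (K : Type u) [Field K] : IsAlternatingVariety (lie K) :=
  ⟨⟨_, rfl⟩, fun A hA => (alternating_iff A).2 ((lie_iff A).1 hA).mul_self⟩

end NonAssocAlgCat

/-! ### The characterisation of Lie algebras among alternating varieties. -/

theorem theorem2p7 (K : Type u) [Field K] [Infinite K] :
    (∀ V : ObjectProperty (NonAssocAlgCat K),
      NonAssocAlgCat.IsAlternatingVariety V → IsLACC V.FullSubcategory →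
        V ≤ NonAssocAlgCat.lie K) ∧
    IsGreatest
      {V : ObjectProperty (NonAssocAlgCat K) |
        NonAssocAlgCat.IsAlternatingVariety V ∧ IsLACC V.FullSubcategory}
      (NonAssocAlgCat.lie K) ∧
    ∀ V : ObjectProperty (NonAssocAlgCat K), NonAssocAlgCat.IsAlternatingVariety V →
      ((∃ W : ObjectProperty (NonAssocAlgCat K),
          NonAssocAlgCat.IsAlternatingVariety W ∧ IsLACC W.FullSubcategory ∧ V ≤ W) ↔
        NonAssocAlgCat.IsLaw V (NAPoly.jacobi K)) := by
  have hle := fun V => NonAssocAlgCat.le_lie_of_isLACC (K := K) (V := V)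
  have hlie := NonAssocAlgCat.isAlternatingVariety_lie K
  have hlacc := NonAssocAlgCat.isLACC_lie K
  refine ⟨hle, ⟨⟨hlie, hlacc⟩, fun V hV => hle V hV.1 hV.2⟩, fun V hV => ⟨?_, fun hJ => ?_⟩⟩
  · rintro ⟨W, hW, hWl, hVW⟩ A hA
    exact (NonAssocAlgCat.satisfies_jacobi_iff A).2
      ((NonAssocAlgCat.lie_iff A).1 (hle W hW hWl A (hVW A hA))).jacobi
  · refine ⟨_, hlie, hlacc, fun A hA => (NonAssocAlgCat.lie_iff A).2 ⟨?_, ?_⟩⟩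
    · exact (NonAssocAlgCat.alternating_iff A).1 (hV.2 A hA)
    · exact (NonAssocAlgCat.satisfies_jacobi_iff A).1 (hJ A hA)
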